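/- **Theorem (the forcing theorem for \*forcing).** Let $M$ be a transitive model of ZFC (a set or a proper class), and let $\mathbf B$ be an $M$-complete Boolean algebra in $M$, possibly a proper class: $\mathbf B\subseteq M$, the class $\mathbf B$ and its order are definable over $(M,\in)$ with parameters from $M$, and every $X\in M$ with $X\subseteq\mathbf B$ has a supremum in $\mathbf B$. Let $\mathbf G$ be an $M$-complete ultrafilter on $\mathbf B$, i.e. an ultrafilter such that whenever $X\in M$, $X\subseteq\mathbf B$ and $\sum X\in\mathbf G$, then $X\cap\mathbf G\neq\emptyset$. For $\alpha\in Ord^M$ let $B_\alpha=\{b\in\mathbf B\mid \mathrm{rank}(b)\le\alpha\}$, and let $M^{\mathbf B}=\bigcup_{\alpha\in Ord^M}M^{B_\alpha}$, where $M^{B_\alpha}$ is the class of all $x\in M$ that are, hereditarily, functions with values in $B_\alpha$ whose domain consists of such functions. For $t,y\in M^{\mathbf B}$ put $\|t\in y\|^*=y(t)$ if $t\in\mathrm{dom}\,y$ and $\|t\in y\|^*=0$ otherwise, and define by recursion $$\|x\in y\|=\sum_{t\in \mathrm{dom}\,y}\|x=t\|\cdot\|t\in y\|^*,$$ $$\|x=y\|=\prod_{t\in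 \mathrm{dom}\,x}\bigl(-\|t\in x\|^*+\|t\in y\|\bigr)\cdot\prod_{t\in \mathrm{dom}\,y}\bigl(-\|t\in y\|^*+\|t\in x\|\bigr).$$ Let $Sent(M,M^{\mathbf B})(q.f.)$ be the class of quantifier-free sentences that are elements of $M$ and are built from the atomic sentences $x=y$ and $x\in y$ ($x,y\in M^{\mathbf B}$) by negation and by conjunctions $\bigwedge_{i\in I}$ and disjunctions $\bigvee_{i\in I}$ indexed by sets $I\in M$, of families $i\mapsto\varphi_i$ that are elements of $M$. Extend $\|\cdot\|$ to these sentences by $$\|\neg\varphi\|=-\|\varphi\|,\qquad \Bigl\|\bigwedge_{i\in I}\varphi_i\Bigr\|=\prod_{i\in I}\|\varphi_i\|,\qquad \Bigl\|\bigvee_{i\in I}\varphi_i\Bigr\|=\sum_{i\in I}\|\varphi_i\|.$$ Finally let $i_{\mathbf G}(x)=\{i_{\mathbf G}(t)\mid t\in\mathrm{dom}\,x,\ x(t)\in\mathbf G\}$ and $M[\mathbf G]=\{i_{\mathbf G}(x)\mid x\in M^{\mathbf B}\}$, with the real membership relation. Then all the sums and products in the definition of $\|\cdot\|$ exist in $\mathbf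 B$, and for every sentence $\varphi(A)\in Sent(M,M^{\mathbf B})(q.f.)$ in the names $A$, $$M[\mathbf G]\models\varphi(A)\quad\text{iff}\quad \|\varphi(A)\|\in\mathbf G,$$ where on the left each name $x$ is interpreted as $i_{\mathbf G}(x)$. -/

import Mathlib

universe u

noncomputable section

namespace StarForcing

open FirstOrder

/-! ### Transitive models of ZFC -/

/-- The relation symbols of the language of set theory: one binary symbol. -/
inductive SetRel : ℕ → Type
  | mem : SetRel 2

/-- The first-order language of set theory. -/
def setLang : Language := ⟨fun _ => Empty, SetRel⟩

/-- A class `M` of sets as a structure with the real membership relation. -/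
instance instSetStructure (M : Set ZFSet.{u}) : setLang.Structure M where
  funMap := fun f => f.elim
  RelMap := fun r => match r with
    | SetRel.mem => fun v => (v 0).1 ∈ (v 1).1

/-- `(M, ∈) ⊨ ZFC`; the two schemes range over all first-order formulas of the language of set
theory, with parameters `p` from `M`. -/
structure ModelsZFC (M : Set ZFSet.{u}) : Prop where
  extensionality : ∀ x y : M, (∀ z : M, z.1 ∈ x.1 ↔ z.1 ∈ y.1) → x = y
  foundation : ∀ x : M, (∃ y : M, y.1 ∈ x.1) →
    ∃ y : M, y.1 ∈ x.1 ∧ ∀ z : M, z.1 ∈ x.1 → z.1 ∉ y.1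
  pairing : ∀ x y : M, ∃ z : M, ∀ w : M, w.1 ∈ z.1 ↔ w = x ∨ w = y
  union : ∀ x : M, ∃ y : M, ∀ z : M, z.1 ∈ y.1 ↔ ∃ w : M, w.1 ∈ x.1 ∧ z.1 ∈ w.1
  powerSet : ∀ x : M, ∃ y : M, ∀ z : M, z.1 ∈ y.1 ↔ ∀ w : M, w.1 ∈ z.1 → w.1 ∈ x.1
  infinity : ∃ x : M, (∃ e : M, e.1 ∈ x.1 ∧ ∀ z : M, z.1 ∉ e.1) ∧
    ∀ y : M, y.1 ∈ x.1 → ∃ s : M, s.1 ∈ x.1 ∧ ∀ z : M, z.1 ∈ s.1 ↔ z.1 ∈ y.1 ∨ z = y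
  separation : ∀ (n : ℕ) (φ : setLang.Formula (Fin (n + 1))) (p : Fin n → M) (a : M),
    ∃ b : M, ∀ z : M, z.1 ∈ b.1 ↔ z.1 ∈ a.1 ∧ φ.Realize (Fin.cons z p)
  replacement : ∀ (n : ℕ) (φ : setLang.Formula (Fin (n + 2))) (p : Fin n → M),
    (∀ x y z : M, φ.Realize (Fin.cons x (Fin.cons y p)) →
      φ.Realize (Fin.cons x (Fin.cons z p)) → y = z) →
    ∀ a : M, ∃ b : M, ∀ y : M,
      y.1 ∈ b.1 ↔ ∃ x : M, x.1 ∈ a.1 ∧ φ.Realize (Fin.cons x (Fin.cons y p))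
  choice : ∀ x : M, (∀ y : M, y.1 ∈ x.1 → ∃ z : M, z.1 ∈ y.1) →
    (∀ y z : M, y.1 ∈ x.1 → z.1 ∈ x.1 → (∃ w : M, w.1 ∈ y.1 ∧ w.1 ∈ z.1) → y = z) →
    ∃ c : M, ∀ y : M, y.1 ∈ x.1 → ∃! w : M, w.1 ∈ y.1 ∧ w.1 ∈ c.1

/-- `M` is a transitive model of ZFC (a set or a proper class). -/
structure IsTransitiveModel (M : Set ZFSet.{u}) : Prop where
  transitive : ∀ x ∈ M, ∀ y ∈ x, y ∈ M
  zfc : ModelsZFC M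

/-! ### Class Boolean algebras in `M` -/

/-- A Boolean algebra whose elements are sets and whose underlying class may be proper. -/
structure ClassBA : Type (u + 1) where
  carrier : Set ZFSet.{u}
  algebra : BooleanAlgebra carrier

/-- The type of elements of a class Boolean algebra. (This is a separate type so that the order
is the one of the algebra, and not inclusion of sets.) -/
def ClassBA.Elem (B : ClassBA.{u}) : Type (u + 1) := B.carrier

instance ClassBA.instBooleanAlgebra (B : ClassBA.{u}) : BooleanAlgebra B.Elem := B.algebra

/-- The set that an element of a class Boolean algebra is. -/
def ClassBA.Elem.val {B : ClassBA.{u}} (b : B.Elem) : ZFSet.{u} := Subtype.val (p := B.carrier) b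

/-- `B` is an `M`-complete Boolean algebra in `M`: it is a class of `M` (its domain and its order
are definable over `(M, ∈)` with parameters from `M`), and every subset of `B` that is an element
of `M` has a supremum in `B`. -/
structure IsCompleteClassBA (M : Set ZFSet.{u}) (B : ClassBA.{u}) : Prop where
  subset : B.carrier ⊆ M
  definable_carrier : (Set.univ : Set M).Definable₁ setLang {x : M | x.1 ∈ B.carrier}
  definable_le : (Set.univ : Set M).Definable₂ setLang
    {p : M × M | ∃ a b : B.Elem, a.val = p.1.1 ∧ b.val = p.2.1 ∧ a ≤ b}
  complete : ∀ X ∈ M, (∀ z ∈ X, z ∈ B.carrier) → ∃ s : B.Elem, IsLUB {b : B.Elem | b.val ∈ X} s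

/-- `G` is an `M`-complete ultrafilter on `B`. -/
structure IsCompleteUltrafilter (M : Set ZFSet.{u}) (B : ClassBA.{u}) (G : Set B.Elem) :
    Prop where
  top_mem : ⊤ ∈ G
  bot_notMem : ⊥ ∉ G
  mem_of_le : ∀ a b : B.Elem, a ∈ G → a ≤ b → b ∈ G
  inf_mem : ∀ a b : B.Elem, a ∈ G → b ∈ G → a ⊓ b ∈ G
  mem_or_compl_mem : ∀ a : B.Elem, a ∈ G ∨ aᶜ ∈ G
  complete : ∀ X ∈ M, (∀ z ∈ X, z ∈ B.carrier) →
    ∀ s ∈ G, IsLUB {b : B.Elem | b.val ∈ X} s → ∃ b ∈ G, b.val ∈ X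

/-! ### Boolean-valued names -/

/-- The domain of a function (or relation) coded as a set of Kuratowski pairs. -/
def dom (x : ZFSet.{u}) : Set ZFSet.{u} := {t | ∃ b, ZFSet.pair t b ∈ x}

/-- `x` is hereditarily a `C`-valued name: a function with values in `C` whose domain consists
of such names. -/
inductive IsName (C : Set ZFSet.{u}) : ZFSet.{u} → Prop
  | mk (x : ZFSet.{u})
      (rel : ∀ p ∈ x, ∃ t, ∃ b ∈ C, p = ZFSet.pair t b)
      (func : ∀ t b b', ZFSet.pair t b ∈ x → ZFSet.pair t b' ∈ x → b = b')
      (dom_name : ∀ t, t ∈ dom x → IsName C t) : IsName C x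

/-- `B_α`, the class of elements of `B` of rank at most the rank of `α` (which is `α` itself when
`α` is a von Neumann ordinal). -/
def ClassBA.level (B : ClassBA.{u}) (α : ZFSet.{u}) : Set ZFSet.{u} :=
  {b | b ∈ B.carrier ∧ b.rank ≤ α.rank}

/-- `M^B`, the union over the ordinals `α` of `M` of the classes `M^{B_α}` of names in `M` with
values in `B_α`. -/
def names (M : Set ZFSet.{u}) (B : ClassBA.{u}) : Set ZFSet.{u} :=
  {x | ∃ α ∈ M, α.IsOrdinal ∧ x ∈ M ∧ IsName (B.level α) x}

/-! ### Quantifier-free infinitary sentences -/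

/-- Quantifier-free sentences, with set-indexed conjunctions and disjunctions, over a class `N` of
names. -/
inductive QFSent (N : Set ZFSet.{u}) : Type (u + 1)
  | eq (x y : N) : QFSent N
  | mem (x y : N) : QFSent N
  | not (φ : QFSent N) : QFSent N
  | iAnd (I : ZFSet.{u}) (φ : {i // i ∈ I} → QFSent N) : QFSent N
  | iOr (I : ZFSet.{u}) (φ : {i // i ∈ I} → QFSent N) : QFSent N

/-- Pairwise distinct hereditarily finite sets, used as symbols. -/
def tag : ℕ → ZFSet.{u}
  | 0 => ∅
  | n + 1 => {tag n}

/-- A sentence as a set; a family of sentences is the function `i ↦ φ i`, a set of pairs. -/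
def QFSent.code {N : Set ZFSet.{u}} : QFSent N → ZFSet.{u}
  | .eq x y => ZFSet.pair (tag 0) (ZFSet.pair x.1 y.1)
  | .mem x y => ZFSet.pair (tag 1) (ZFSet.pair x.1 y.1)
  | .not φ => ZFSet.pair (tag 2) φ.code
  | .iAnd I φ => ZFSet.pair (tag 3)
      (ZFSet.range fun i : {i // i ∈ I} => ZFSet.pair i.1 (φ i).code)
  | .iOr I φ => ZFSet.pair (tag 4)
      (ZFSet.range fun i : {i // i ∈ I} => ZFSet.pair i.1 (φ i).code)

/-- `Sent(M, M^B)(q.f.)`: the quantifier-free sentences over `M^B` that are elements of `M`. -/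
def qfSent (M : Set ZFSet.{u}) (B : ClassBA.{u}) : Set (QFSent (names M B)) :=
  {φ | φ.code ∈ M}

/-- Satisfaction of a sentence in `(S, ∈)`, where `i` interprets the names in `S`. -/
def QFSent.Holds {N S : Set ZFSet.{u}} (i : N → S) : QFSent N → Prop
  | .eq x y => i x = i y
  | .mem x y => (i x).1 ∈ (i y).1
  | .not φ => ¬ φ.Holds i
  | .iAnd _ φ => ∀ j, (φ j).Holds i
  | .iOr _ φ => ∃ j, (φ j).Holds i

/-! ### Boolean values -/

open Classical in
/-- `∑ X`, the supremum of `X` (and `⊥` if there is none). -/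
def bSum {B : ClassBA.{u}} (X : Set B.Elem) : B.Elem :=
  if h : ∃ s, IsLUB X s then h.choose else ⊥

open Classical in
/-- `∏ X`, the infimum of `X` (and `⊥` if there is none). -/
def bProd {B : ClassBA.{u}} (X : Set B.Elem) : B.Elem :=
  if h : ∃ s, IsGLB X s then h.choose else ⊥

open Classical in
/-- `||t ∈ y||^*`, which is `y(t)` if `t ∈ dom y`, and `0` otherwise. -/
def starMem {B : ClassBA.{u}} (t y : ZFSet.{u}) : B.Elem :=
  if h : ∃ b : B.Elem, ZFSet.pair t b.val ∈ y then h.choose else ⊥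

theorem rank_lt_of_mem_dom {t x : ZFSet.{u}} (h : t ∈ dom x) : t.rank < x.rank := by
  obtain ⟨b, hb⟩ := h
  have h1 : t ∈ ({t} : ZFSet.{u}) := by simp
  have h2 : ({t} : ZFSet.{u}) ∈ ZFSet.pair t b := by simp [ZFSet.pair]
  exact (ZFSet.rank_lt_of_mem h1).trans ((ZFSet.rank_lt_of_mem h2).trans (ZFSet.rank_lt_of_mem hb))

theorem lex_left {a b c : Ordinal.{u}} (h : a < b) :
    Prod.Lex (· < ·) (· < ·) (max a c, min a c) (max b c, min b c) := by
  rw [Prod.lex_def]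
  rcases le_total b c with hbc | hbc
  · right
    simp [max_eq_right hbc, min_eq_left hbc, max_eq_right (h.le.trans hbc), h]
  · rcases hbc.lt_or_eq with hcb | rfl
    · left
      simp [max_eq_left hbc, h, hcb]
    · right
      simp [max_eq_right h.le, h]

theorem lex_right {a b c : Ordinal.{u}} (h : a < b) :
    Prod.Lex (· < ·) (· < ·) (max c a, min c a) (max c b, min c b) := by
  simpa only [max_comm c, min_comm c] using lex_left h

theorem lex_swap {a b c : Ordinal.{u}} (h : a < b) :
    Prod.Lex (· < ·) (· < ·) (max a c, min a c) (max c b, min c b) := by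
  simpa only [max_comm c, min_comm c] using lex_left h

mutual

/-- `||x = y||`. -/
def valEq {B : ClassBA.{u}} (x y : ZFSet.{u}) : B.Elem :=
  bProd {c | ∃ t, ∃ _ : t ∈ dom x, c = (starMem t x)ᶜ ⊔ valMem t y} ⊓
    bProd {c | ∃ t, ∃ _ : t ∈ dom y, c = (starMem t y)ᶜ ⊔ valMem t x}
termination_by (max x.rank y.rank, min x.rank y.rank)
decreasing_by
  · exact lex_left (rank_lt_of_mem_dom (by assumption))
  · exact lex_swap (rank_lt_of_mem_dom (by assumption))

/-- `||x ∈ y||`. -/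
def valMem {B : ClassBA.{u}} (x y : ZFSet.{u}) : B.Elem :=
  bSum {c | ∃ t, ∃ _ : t ∈ dom y, c = valEq x t ⊓ starMem t y}
termination_by (max x.rank y.rank, min x.rank y.rank)
decreasing_by
  exact lex_right (rank_lt_of_mem_dom (by assumption))

end

/-- `||φ||` for quantifier-free sentences. -/
def QFSent.val {N : Set ZFSet.{u}} (B : ClassBA.{u}) : QFSent N → B.Elem
  | .eq x y => valEq x.1 y.1
  | .mem x y => valMem x.1 y.1
  | .not φ => (φ.val B)ᶜ
  | .iAnd _ φ => bProd (Set.range fun j => (φ j).val B)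
  | .iOr _ φ => bSum (Set.range fun j => (φ j).val B)

/-- All the sums and products in the definition of `||φ||`, for `φ` a quantifier-free sentence
over `M^B` in `M`, exist in `B`. -/
structure ValuesDefined (M : Set ZFSet.{u}) (B : ClassBA.{u}) : Prop where
  eq : ∀ x ∈ names M B, ∀ y ∈ names M B, ∃ s : B.Elem,
    IsGLB {c | ∃ t ∈ dom x, c = (starMem t x)ᶜ ⊔ valMem t y} s
  mem : ∀ x ∈ names M B, ∀ y ∈ names M B, ∃ s : B.Elem,
    IsLUB {c | ∃ t ∈ dom y, c = valEq x t ⊓ starMem t y} s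
  iAnd : ∀ I φ, QFSent.iAnd I φ ∈ qfSent M B →
    ∃ s : B.Elem, IsGLB (Set.range fun j => (φ j).val B) s
  iOr : ∀ I φ, QFSent.iOr I φ ∈ qfSent M B →
    ∃ s : B.Elem, IsLUB (Set.range fun j => (φ j).val B) s

/-! ### The extension `M[G]` -/

/-- `i_G(x) = {i_G(t) | t ∈ dom x, x(t) ∈ G}`. (Every such `t` is an element of `⋃ ⋃ x`, so the
index type is just `{t | ∃ b ∈ G, (t, b) ∈ x}`, written so that it is visibly a set.) -/
def interp {B : ClassBA.{u}} (G : Set B.Elem) (x : ZFSet.{u}) : ZFSet.{u} :=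
  ZFSet.range fun t : {t : {t // t ∈ ZFSet.sUnion (ZFSet.sUnion x)} //
    ∃ b ∈ G, ZFSet.pair t.1 b.val ∈ x} => interp G t.1.1
termination_by x.rank
decreasing_by
  obtain ⟨b, _, hb⟩ := t.2
  exact rank_lt_of_mem_dom ⟨_, hb⟩

/-- `M[G] = {i_G(x) | x ∈ M^B}`. -/
def extension (M : Set ZFSet.{u}) (B : ClassBA.{u}) (G : Set B.Elem) : Set ZFSet.{u} :=
  interp G '' names M B

/-- `i_G` as a function from `M^B` to `M[G]`. -/
def interpName (M : Set ZFSet.{u}) (B : ClassBA.{u}) (G : Set B.Elem) (x : names M B) :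
    extension M B G :=
  ⟨interp G x.1, x.1, x.2, rfl⟩

/-- `(M, M^B, || ||, G)` is a *forcing notion; `M^B` and `|| ||` are determined by `M` and `B`. -/
structure IsStarForcingNotion (M : Set ZFSet.{u}) (B : ClassBA.{u}) (G : Set B.Elem) : Prop where
  model : IsTransitiveModel M
  algebra : IsCompleteClassBA M B
  ultrafilter : IsCompleteUltrafilter M B G

end StarForcing

end

noncomputable section

namespace StarForcing

open FirstOrder

/-! ### Definability over a class of sets -/

-- Completeness of `B` and of `G` concerns only subsets of `B` that are elements of `M`. The theorem
-- therefore reduces to one point: the set of values over which each sum or product is taken must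
-- belong to `M`. Given this, suprema exist by completeness of `B`, infima by De Morgan, and `G`
-- contains a sum iff it meets the set of summands, and a product iff it contains all factors.
-- Induction on rank then gives `valEq_mem_iff` and `valMem_mem_iff`, and induction on sentences
-- gives `holds_iff_val_mem`.
--
-- The sets of values come from replacement in `M`, which requires the Boolean values to be
-- definable over `M`. These values are defined outside `M`, by recursion, with a dummy value where
-- a supremum is missing. `IsRecursion` isolates what suffices: a definable well-founded relation
-- with set-bounded predecessors, and a definable step that computes the value from any element of
-- `M` recording the values at the predecessors. Then `IsRecursion.exists_def` shows that the given
-- function is definable on its domain `D`. The domain itself need not be definable.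
--
-- This is applied twice: to equality of names, with membership eliminated (`isRecursion_valEq`),
-- and to codes of sentences (`isRecursion_val`). In each step the recorded predecessor values
-- already place the relevant sets of values in `M`, so the existence of the sums and their
-- definability are obtained together.
--
-- Formulas are almost never written out. `Def` is closed under connectives, quantifiers and
-- substitution of definable functions, and `DefinableType` allows quantification over tuples and
-- over elements of `B` as well as over `M`.

/-- A type whose elements are finite tuples from `M`, forming a class that is definable
with parameters. -/
class DefinableType (M : Set ZFSet.{u}) (α : Type*) where
  ι : Type
  finite : Finite ι
  enc : α → ι → M
  enc_injective : Function.Injective enc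
  definable_range : (Set.univ : Set M).Definable setLang (Set.range enc)

attribute [instance] DefinableType.finite

open DefinableType

/-- A predicate definable over `M` with parameters. -/
def Def (M : Set ZFSet.{u}) {α : Type*} [DefinableType M α] (P : α → Prop) : Prop :=
  (Set.univ : Set M).Definable setLang (enc (M := M) '' {a | P a})

instance instDefinableTypeSelf (M : Set ZFSet.{u}) : DefinableType M M where
  ι := Unit
  finite := inferInstance
  enc x _ := x
  enc_injective x y h := congrFun h ()
  definable_range := by
    rw [(Set.range_eq_univ (f := fun (x : M) (_ : Unit) => x)).2 fun v => ⟨v (), rfl⟩]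
    exact Set.definable_univ

instance instDefinableTypeProd (M : Set ZFSet.{u}) (α β : Type*) [DefinableType M α]
    [DefinableType M β] : DefinableType M (α × β) where
  ι := ι M α ⊕ ι M β
  finite := inferInstance
  enc p := Sum.elim (enc p.1) (enc p.2)
  enc_injective p q h := by
    rw [Sum.elim_eq_iff] at h
    exact Prod.ext (enc_injective h.1) (enc_injective h.2)
  definable_range := by
    have h : (Set.range fun p : α × β => (Sum.elim (enc p.1) (enc p.2) : ι M α ⊕ ι M β → M)) =
        (fun v => v ∘ Sum.inl) ⁻¹' Set.range (enc (M := M) (α := α)) ∩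
          (fun v => v ∘ Sum.inr) ⁻¹' Set.range (enc (M := M) (α := β)) := by
      ext v
      constructor
      · rintro ⟨p, rfl⟩
        exact ⟨⟨p.1, rfl⟩, ⟨p.2, rfl⟩⟩
      · rintro ⟨⟨a, ha⟩, ⟨b, hb⟩⟩
        refine ⟨(a, b), ?_⟩
        simp only [ha, hb]
        exact Sum.elim_comp_inl_inr v
    rw [h]
    exact (definable_range.preimage_comp Sum.inl).inter (definable_range.preimage_comp Sum.inr)

variable {M : Set ZFSet.{u}} {α β γ : Type*} [DefinableType M α] [DefinableType M β]
  [DefinableType M γ]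

/-- A function whose graph is definable over `M` with parameters. -/
def DefFun (M : Set ZFSet.{u}) {α β : Type*} [DefinableType M α] [DefinableType M β]
    (f : α → β) : Prop :=
  Def M fun p : α × β => p.2 = f p.1

theorem definable_of_subset_of_subset {κ : Type*} {s t : Set (κ → M)}
    (h : (Set.univ : Set M).Definable setLang t) (hst : s ⊆ t) (hts : t ⊆ s) :
    (Set.univ : Set M).Definable setLang s :=
  hst.antisymm hts ▸ h

namespace Def

theorem and {P Q : α → Prop} (hP : Def M P) (hQ : Def M Q) : Def M fun a => P a ∧ Q a := by
  unfold Def at *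
  have h : {a | P a ∧ Q a} = {a | P a} ∩ {a | Q a} := rfl
  rw [h, Set.image_inter enc_injective]
  exact hP.inter hQ

/-- The complement is taken inside the class of encoded tuples, which is why `definable_range` is
part of `DefinableType`. -/
theorem not {P : α → Prop} (hP : Def M P) : Def M fun a => ¬ P a := by
  unfold Def at *
  have h : {a | ¬ P a} = {a | P a}ᶜ := rfl
  rw [h, Set.image_compl_eq_range_sdiff_image enc_injective]
  exact definable_range.sdiff hP

theorem congr {P Q : α → Prop} (hP : Def M P) (h : ∀ a, Q a ↔ P a) : Def M Q := by
  rwa [show Q = P from funext fun a => propext (h a)]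

theorem or {P Q : α → Prop} (hP : Def M P) (hQ : Def M Q) : Def M fun a => P a ∨ Q a :=
  (hP.not.and hQ.not).not.congr fun _ => by tauto

theorem imp {P Q : α → Prop} (hP : Def M P) (hQ : Def M Q) : Def M fun a => P a → Q a :=
  (hP.and hQ.not).not.congr fun _ => by tauto

theorem iff {P Q : α → Prop} (hP : Def M P) (hQ : Def M Q) : Def M fun a => (P a ↔ Q a) :=
  ((hP.imp hQ).and (hQ.imp hP)).congr fun _ => by tauto

/-- Existential quantification is projection that forgets the coordinates of `β`. There are finitely
many of them, so the projection is again definable. -/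
theorem ex {P : α → β → Prop} (hP : Def M fun p : α × β => P p.1 p.2) :
    Def M fun a => ∃ b, P a b := by
  have h := hP.image_comp (Sum.inl : ι M α → ι M α ⊕ ι M β)
  rw [← Set.image_comp] at h
  refine definable_of_subset_of_subset h ?_ ?_
  · rintro _ ⟨a, ⟨b, hb⟩, rfl⟩
    exact ⟨(a, b), hb, rfl⟩
  · rintro _ ⟨p, hp, rfl⟩
    exact ⟨p.1, ⟨p.2, hp⟩, rfl⟩

theorem all {P : α → β → Prop} (hP : Def M fun p : α × β => P p.1 p.2) :
    Def M fun a => ∀ b, P a b :=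
  (ex (P := fun a b => ¬ P a b) hP.not).not.congr fun _ => by simp

theorem eq_snd_fst : Def M fun p : α × α => p.2 = p.1 := by
  have h : (Set.univ : Set M).Definable setLang
      (⋂ i : ι M α, {v : ι M α ⊕ ι M α → M | v (Sum.inl i) = v (Sum.inr i)}) := by
    refine Set.definable_iInter_of_finite fun i => ?_
    exact ⟨((Language.var (Sum.inl i)).equal (Language.var (Sum.inr i)) :
      (setLang[[(Set.univ : Set M)]]).Formula (ι M α ⊕ ι M α)), by ext; simp⟩
  refine definable_of_subset_of_subset (h.inter (definable_range (M := M) (α := α × α))) ?_ ?_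
  · rintro _ ⟨p, hp, rfl⟩
    refine ⟨Set.mem_iInter.2 fun i => ?_, ⟨p, rfl⟩⟩
    have hp : p.2 = p.1 := hp
    change enc p.1 i = enc p.2 i
    rw [hp]
  · rintro _ ⟨hv, ⟨p, rfl⟩⟩
    exact ⟨p, enc_injective (M := M) (funext fun i => (Set.mem_iInter.1 hv i).symm), rfl⟩

/-- Substitution of variables. -/
theorem reindex {P : β → Prop} (hP : Def M P) (g : α → β) (σ : ι M β → ι M α)
    (hσ : ∀ a, enc (M := M) (g a) = enc a ∘ σ) : Def M fun a => P (g a) := by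
  refine definable_of_subset_of_subset
    ((hP.preimage_comp σ).inter (definable_range (M := M) (α := α))) ?_ ?_
  · rintro _ ⟨p, hp, rfl⟩
    exact ⟨⟨g p, hp, hσ p⟩, ⟨p, rfl⟩⟩
  · rintro _ ⟨⟨b, hb, h⟩, ⟨p, rfl⟩⟩
    refine ⟨p, ?_, rfl⟩
    have e : b = g p := enc_injective (M := M) (h.trans (hσ p).symm)
    rwa [e] at hb

theorem fst {P : α → Prop} (hP : Def M P) : Def M fun p : α × β => P p.1 :=
  hP.reindex Prod.fst Sum.inl fun _ => rfl

theorem snd {P : β → Prop} (hP : Def M P) : Def M fun p : α × β => P p.2 :=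
  hP.reindex Prod.snd Sum.inr fun _ => rfl

/-- The language has no function symbols, so the value of `f` is introduced by an existential
quantifier over its graph. -/
theorem comp {P : β → Prop} (hP : Def M P) {f : α → β} (hf : DefFun M f) :
    Def M fun a => P (f a) :=
  (ex (P := fun a b => b = f a ∧ P b) (hf.and hP.snd)).congr fun a => by simp

end Def

namespace DefFun

protected theorem id : DefFun M fun a : α => a := Def.eq_snd_fst

protected theorem const (b : β) : DefFun M fun _ : α => b := by
  refine Def.snd (P := fun b' => b' = b) ?_
  have h : (Set.univ : Set M).Definable setLang
      (⋂ i : ι M β, {v : ι M β → M | v i = enc b i}) := by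
    refine Set.definable_iInter_of_finite fun i => ?_
    exact ⟨((Language.var i).equal
      (Language.Constants.term (setLang.con (⟨enc b i, trivial⟩ : (Set.univ : Set M)))) :
      (setLang[[(Set.univ : Set M)]]).Formula (ι M β)), by ext; simp⟩
  refine definable_of_subset_of_subset h ?_ ?_
  · rintro _ ⟨_, rfl, rfl⟩
    exact Set.mem_iInter.2 fun i => rfl
  · intro v hv
    exact ⟨b, rfl, funext fun i => (Set.mem_iInter.1 hv i).symm⟩

theorem comp {g : β → γ} (hg : DefFun M g) {f : α → β} (hf : DefFun M f) :
    DefFun M fun a => g (f a) := by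
  have h : Def M fun p : (α × γ) × β => p.2 = f p.1.1 ∧ p.1.2 = g p.2 :=
    (hf.reindex (fun p : (α × γ) × β => (p.1.1, p.2)) (Sum.map Sum.inl id)
      fun p => funext fun i => by rcases i with i | i <;> rfl).and
    (hg.reindex (fun p : (α × γ) × β => (p.2, p.1.2)) (Sum.elim Sum.inr (Sum.inl ∘ Sum.inr))
      fun p => funext fun i => by rcases i with i | i <;> rfl)
  exact (Def.ex (P := fun (p : α × γ) b => b = f p.1 ∧ p.2 = g b) h).congr fun p => by simp

theorem fst {f : α → β × γ} (hf : DefFun M f) : DefFun M fun a => (f a).1 :=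
  comp (g := Prod.fst) ((Def.eq_snd_fst (M := M) (α := β)).reindex
    (fun p : (β × γ) × β => (p.1.1, p.2)) (Sum.map Sum.inl id)
      fun p => funext fun i => by rcases i with i | i <;> rfl) hf

theorem snd {f : α → β × γ} (hf : DefFun M f) : DefFun M fun a => (f a).2 :=
  comp (g := Prod.snd) ((Def.eq_snd_fst (M := M) (α := γ)).reindex
    (fun p : (β × γ) × γ => (p.1.2, p.2)) (Sum.map Sum.inr id)
      fun p => funext fun i => by rcases i with i | i <;> rfl) hf

theorem prodMk {f : α → β} {g : α → γ} (hf : DefFun M f) (hg : DefFun M g) :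
    DefFun M fun a => (f a, g a) := by
  have h : Def M fun p : α × (β × γ) => p.2.1 = f p.1 ∧ p.2.2 = g p.1 :=
    (hf.reindex (fun p : α × (β × γ) => (p.1, p.2.1)) (Sum.map id Sum.inl)
      fun p => funext fun i => by rcases i with i | i <;> rfl).and
    (hg.reindex (fun p : α × (β × γ) => (p.1, p.2.2)) (Sum.map id Sum.inr)
      fun p => funext fun i => by rcases i with i | i <;> rfl)
  exact h.congr fun p => Prod.ext_iff

end DefFun

namespace Def

theorem comp₂ {P : α → β → Prop} (hP : Def M fun p : α × β => P p.1 p.2) {f : γ → α}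
    {g : γ → β} (hf : DefFun M f) (hg : DefFun M g) : Def M fun c => P (f c) (g c) :=
  hP.comp (hf.prodMk hg)

theorem eq {f g : α → β} (hf : DefFun M f) (hg : DefFun M g) : Def M fun a => f a = g a :=
  (comp₂ (P := fun a b : β => b = a) eq_snd_fst hg hf)

theorem of_definable₂ {S : Set (M × M)} (hS : (Set.univ : Set M).Definable₂ setLang S) :
    Def M fun x : M × M => x ∈ S := by
  have h := hS.preimage_comp (![Sum.inl (), Sum.inr ()] : Fin 2 → Unit ⊕ Unit)
  refine definable_of_subset_of_subset h ?_ ?_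
  · rintro _ ⟨p, hp, rfl⟩
    exact hp
  · intro v hv
    exact ⟨(v (Sum.inl ()), v (Sum.inr ())), hv, funext fun i => by rcases i with i | i <;> rfl⟩

theorem mem_fst_snd : Def M fun p : M × M => p.1.1 ∈ p.2.1 := by
  refine of_definable₂ (S := {p | p.1.1 ∈ p.2.1})
    (Set.Definable.mono (A := ∅) ?_ (Set.empty_subset _))
  rw [Set.empty_definable_iff]
  exact ⟨Language.Relations.formula₂ (SetRel.mem : setLang.Relations 2) (Language.var 0)
    (Language.var 1), by ext; simp; rfl⟩

theorem mem {f g : α → M} (hf : DefFun M f) (hg : DefFun M g) :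
    Def M fun a => (f a).1 ∈ (g a).1 :=
  comp₂ (P := fun a b : M => a.1 ∈ b.1) mem_fst_snd hf hg

/-- A definable relation is given by a formula with finitely many parameters. -/
theorem exists_formula {k : ℕ} {S : Set (Fin k → M)}
    (hS : (Set.univ : Set M).Definable setLang S) :
    ∃ (n : ℕ) (φ : setLang.Formula (Fin k ⊕ Fin n)) (p : Fin n → M),
      ∀ v, v ∈ S ↔ φ.Realize (Sum.elim v p) := by
  -- A formula uses finitely many parameters. They become extra free variables, which is the form in
  -- which the axiom schemes are stated.
  obtain ⟨A, -, hA⟩ := Set.definable_iff_finitely_definable.1 hS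
  obtain ⟨φ, rfl⟩ := Set.definable_iff_exists_formula_sum.1 hA
  let e := A.equivFin
  refine ⟨A.card, φ.relabel (Sum.elim (fun a => Sum.inr (e a)) Sum.inl),
    fun i => (e.symm i).1, fun v => ?_⟩
  rw [Language.Formula.realize_relabel, Set.mem_ofPred_eq]
  refine iff_of_eq (congrArg _ (funext fun i => ?_))
  rcases i with i | i <;> simp

end Def
theorem DefFun.of_graph {f : α → β} (h : Def M fun p : α × β => p.2 = f p.1) : DefFun M f := h

attribute [irreducible] Def DefFun

end StarForcing

end

noncomputable section

namespace StarForcing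

open FirstOrder DefinableType

/-! ### Transitive models of ZFC -/

variable {M : Set ZFSet.{u}} {α β γ : Type*} [DefinableType M α] [DefinableType M β]
  [DefinableType M γ]

namespace IsTransitiveModel

variable (hM : IsTransitiveModel M)
include hM

theorem mem_of_mem {x y : ZFSet.{u}} (hx : x ∈ M) (hy : y ∈ x) : y ∈ M :=
  hM.transitive x hx y hy

theorem ext {x y : M} (h : ∀ z : M, z.1 ∈ x.1 ↔ z.1 ∈ y.1) : x = y :=
  hM.zfc.extensionality x y h

theorem exists_sep {P : M → Prop} (hP : Def M P) (a : M) :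
    ∃ b : M, ∀ z : M, z.1 ∈ b.1 ↔ z.1 ∈ a.1 ∧ P z := by
  unfold Def at hP
  have h := hP.preimage_comp (fun _ : Unit => (0 : Fin 1))
  obtain ⟨n, φ, p, hφ⟩ := Def.exists_formula h
  obtain ⟨b, hb⟩ := hM.zfc.separation n (φ.relabel (Sum.elim (fun _ => 0) Fin.succ)) p a
  refine ⟨b, fun z => (hb z).trans (and_congr_right fun _ => ?_)⟩
  have e : (Fin.cons z p : Fin (n + 1) → M) ∘ (Sum.elim (fun _ => 0) Fin.succ) =
      Sum.elim (fun _ : Fin 1 => z) p := by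
    ext i; rcases i with i | i <;> rfl
  rw [Language.Formula.realize_relabel, e, ← hφ]
  constructor
  · rintro ⟨x, hx, h⟩
    have e : x = z := congrFun h ()
    exact e ▸ hx
  · intro hz
    exact ⟨z, hz, rfl⟩

theorem exists_replace {R : M → M → Prop} (hR : Def M fun p : M × M => R p.1 p.2) (a : M)
    (hfun : ∀ x : M, x.1 ∈ a.1 → ∀ y z, R x y → R x z → y = z) :
    ∃ b : M, ∀ y : M, y.1 ∈ b.1 ↔ ∃ x : M, x.1 ∈ a.1 ∧ R x y := by
  -- The axiom asks for functionality on all of `M`, but `R` is functional only on `a`; so the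
  -- relation is first restricted to `a`.
  have hR' : Def M fun p : M × M => R p.1 p.2 ∧ p.1.1 ∈ a.1 :=
    hR.and (Def.mem DefFun.id.fst (.const a))
  unfold Def at hR'
  have h := hR'.preimage_comp (Sum.elim (fun _ : Unit => (0 : Fin 2)) (fun _ : Unit => (1 : Fin 2)))
  obtain ⟨n, φ, p, hφ⟩ := Def.exists_formula h
  let ψ := φ.relabel (Sum.elim ![0, 1] (fun i => i.succ.succ) : Fin 2 ⊕ Fin n → Fin (n + 2))
  have hψ : ∀ x y : M, ψ.Realize (Fin.cons x (Fin.cons y p)) ↔ R x y ∧ x.1 ∈ a.1 := by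
    intro x y
    have e : (Fin.cons x (Fin.cons y p) : Fin (n + 2) → M) ∘
        (Sum.elim ![0, 1] (fun i => i.succ.succ)) = Sum.elim ![x, y] p := by
      ext i
      rcases i with i | i
      · fin_cases i <;> rfl
      · rfl
    rw [Language.Formula.realize_relabel, e, ← hφ]
    constructor
    · rintro ⟨⟨x', y'⟩, hx, h⟩
      have h1 : x' = x := congrFun h (.inl ())
      have h2 : y' = y := congrFun h (.inr ())
      subst h1 h2
      exact hx
    · intro hz
      exact ⟨(x, y), hz, funext fun i => by rcases i with i | i <;> rfl⟩
  obtain ⟨b, hb⟩ := hM.zfc.replacement n ψ p (fun x y z hy hz => by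
    rw [hψ] at hy hz
    exact hfun x hy.2 y z hy.1 hz.1) a
  refine ⟨b, fun y => (hb y).trans (exists_congr fun x => ?_)⟩
  rw [hψ]
  tauto

theorem unordered_mem {x y : ZFSet.{u}} (hx : x ∈ M) (hy : y ∈ M) : ({x, y} : ZFSet.{u}) ∈ M := by
  obtain ⟨z, hz⟩ := hM.zfc.pairing ⟨x, hx⟩ ⟨y, hy⟩
  convert z.2
  ext w
  rw [ZFSet.mem_pair]
  constructor
  · rintro (rfl | rfl)
    · exact (hz ⟨_, hx⟩).2 (.inl rfl)
    · exact (hz ⟨_, hy⟩).2 (.inr rfl)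
  · intro hw
    simpa [Subtype.ext_iff] using (hz ⟨w, hM.mem_of_mem z.2 hw⟩).1 hw

theorem singleton_mem {x : ZFSet.{u}} (hx : x ∈ M) : ({x} : ZFSet.{u}) ∈ M := by
  simpa using hM.unordered_mem hx hx

theorem pair_mem {x y : ZFSet.{u}} (hx : x ∈ M) (hy : y ∈ M) : ZFSet.pair x y ∈ M :=
  hM.unordered_mem (hM.singleton_mem hx) (hM.unordered_mem hx hy)

theorem sUnion_mem {x : ZFSet.{u}} (hx : x ∈ M) : ZFSet.sUnion x ∈ M := by
  obtain ⟨y, hy⟩ := hM.zfc.union ⟨x, hx⟩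
  convert y.2
  ext w
  rw [ZFSet.mem_sUnion]
  constructor
  · rintro ⟨z, hz, hw⟩
    have hz' := hM.mem_of_mem hx hz
    exact (hy ⟨w, hM.mem_of_mem hz' hw⟩).2 ⟨⟨z, hz'⟩, hz, hw⟩
  · intro hw
    obtain ⟨z, hz, hw⟩ := (hy ⟨w, hM.mem_of_mem y.2 hw⟩).1 hw
    exact ⟨z.1, hz, hw⟩

theorem union_mem {x y : ZFSet.{u}} (hx : x ∈ M) (hy : y ∈ M) : x ∪ y ∈ M :=
  hM.sUnion_mem (hM.unordered_mem hx hy)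

theorem exists_powerset (x : M) : ∃ y : M, ∀ z : M, z.1 ⊆ x.1 → z.1 ∈ y.1 := by
  obtain ⟨y, hy⟩ := hM.zfc.powerSet x
  exact ⟨y, fun z hz => (hy z).2 fun w hw => hz hw⟩

theorem empty_mem : (∅ : ZFSet.{u}) ∈ M := by
  obtain ⟨x, ⟨e, -, he⟩, -⟩ := hM.zfc.infinity
  convert e.2
  ext w
  refine ⟨fun h => absurd h (ZFSet.notMem_empty _), fun h => ?_⟩
  exact absurd h (he ⟨w, hM.mem_of_mem e.2 h⟩)

theorem tag_mem : ∀ n, tag.{u} n ∈ M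
  | 0 => hM.empty_mem
  | n + 1 => hM.singleton_mem (tag_mem n)

theorem left_mem {x y : ZFSet.{u}} (h : ZFSet.pair x y ∈ M) : x ∈ M :=
  hM.mem_of_mem (hM.mem_of_mem h (y := {x, y}) (by simp [ZFSet.pair])) (by simp)

theorem right_mem {x y : ZFSet.{u}} (h : ZFSet.pair x y ∈ M) : y ∈ M :=
  hM.mem_of_mem (hM.mem_of_mem h (y := {x, y}) (by simp [ZFSet.pair])) (by simp)

/-- By transitivity the elements of `f a` all lie in `M`, so the extensional description may
quantify over `M` only. -/
theorem def_eq_unordered {f g k : α → M} (hf : DefFun M f) (hg : DefFun M g) (hk : DefFun M k) :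
    Def M fun a => (f a).1 = {(g a).1, (k a).1} := by
  refine (Def.all (P := fun a (w : M) => w.1 ∈ (f a).1 ↔ w = g a ∨ w = k a)
    ((Def.mem DefFun.id.snd (hf.comp DefFun.id.fst)).iff
      ((Def.eq DefFun.id.snd (hg.comp DefFun.id.fst)).or
        (Def.eq DefFun.id.snd (hk.comp DefFun.id.fst))))).congr fun a => ?_
  constructor
  · intro h w
    rw [h, ZFSet.mem_pair, Subtype.ext_iff, Subtype.ext_iff]
  · intro h
    ext w
    rw [ZFSet.mem_pair]
    constructor
    · intro hw
      have := (h ⟨w, hM.mem_of_mem (f a).2 hw⟩).1 hw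
      simpa [Subtype.ext_iff] using this
    · rintro (rfl | rfl)
      · exact (h _).2 (.inl rfl)
      · exact (h _).2 (.inr rfl)

theorem def_eq_pair {f g k : α → M} (hf : DefFun M f) (hg : DefFun M g) (hk : DefFun M k) :
    Def M fun a => (f a).1 = ZFSet.pair (g a).1 (k a).1 := by
  have h : Def M fun p : (α × M) × M => p.1.2.1 = {(g p.1.1).1, (g p.1.1).1} ∧
      p.2.1 = {(g p.1.1).1, (k p.1.1).1} ∧ (f p.1.1).1 = {p.1.2.1, p.2.1} :=
    (hM.def_eq_unordered DefFun.id.fst.snd (hg.comp DefFun.id.fst.fst)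
      (hg.comp DefFun.id.fst.fst)).and ((hM.def_eq_unordered DefFun.id.snd
        (hg.comp DefFun.id.fst.fst) (hk.comp DefFun.id.fst.fst)).and (hM.def_eq_unordered
          (hf.comp DefFun.id.fst.fst) DefFun.id.fst.snd DefFun.id.snd))
  refine (Def.ex (P := fun a (s : M) => ∃ d : M, s.1 = {(g a).1, (g a).1} ∧
    d.1 = {(g a).1, (k a).1} ∧ (f a).1 = {s.1, d.1}) (.ex h)).congr fun a => ?_
  constructor
  · intro h
    exact ⟨⟨_, hM.singleton_mem (g a).2⟩, ⟨_, hM.unordered_mem (g a).2 (k a).2⟩, by simp, rfl, h⟩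
  · rintro ⟨s, d, hs, hd, h⟩
    rw [h, hs, hd]
    simp [ZFSet.pair]

theorem def_pair_mem {f g k : α → M} (hf : DefFun M f) (hg : DefFun M g) (hk : DefFun M k) :
    Def M fun a => ZFSet.pair (g a).1 (k a).1 ∈ (f a).1 := by
  refine (Def.ex (P := fun a (p : M) => p.1 = ZFSet.pair (g a).1 (k a).1 ∧ p.1 ∈ (f a).1)
    ((hM.def_eq_pair DefFun.id.snd (hg.comp DefFun.id.fst) (hk.comp DefFun.id.fst)).and
      (Def.mem DefFun.id.snd (hf.comp DefFun.id.fst)))).congr fun a => ?_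
  exact ⟨fun h => ⟨⟨_, hM.mem_of_mem (f a).2 h⟩, rfl, h⟩, fun ⟨p, hp, h⟩ => hp ▸ h⟩

end IsTransitiveModel

end StarForcing

end

noncomputable section

namespace StarForcing

open FirstOrder DefinableType

/-! ### Definition by recursion in a transitive model -/

/-- `g` contains partial solutions of the recursion `y = f x ↔ H x g y` along the relation `P`. -/
def IsApprox {M : Set ZFSet.{u}} (P : M → M → Prop) (H : M → M → M → Prop) (g : M) : Prop :=
  ∀ x y : M, ZFSet.pair x.1 y.1 ∈ g.1 →
    H x g y ∧ ∀ z, P z x → ∃ w : M, ZFSet.pair z.1 w.1 ∈ g.1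

/-- `f` is on `D` the solution of the recursion `y = f x ↔ H x g y` along the relation `P`, where
`g` is any element of `M` which agrees with `f` on the predecessors of `x`. -/
structure IsRecursion {M : Set ZFSet.{u}} (P : M → M → Prop) (H : M → M → M → Prop) (D : Set M)
    (f : M → M) : Prop where
  wf : WellFounded P
  def_pred : Def M fun p : M × M => P p.1 p.2
  def_step : Def M fun p : (M × M) × M => H p.1.1 p.1.2 p.2
  mem_of_pred : ∀ x ∈ D, ∀ z, P z x → z ∈ D
  bound : ∀ x ∈ D, ∃ a : M, ∀ z, P z x → z.1 ∈ a.1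
  step : ∀ x ∈ D, ∀ g : M, (∀ z, P z x → ∀ w : M, ZFSet.pair z.1 w.1 ∈ g.1 ↔ w = f z) →
    ∀ y, H x g y ↔ y = f x

namespace IsRecursion

variable {M : Set ZFSet.{u}} {P : M → M → Prop} {H : M → M → M → Prop} {D : Set M} {f : M → M}

/-- An approximation is not assumed to be a function, nor to live over `D`. By well-founded
induction its values at predecessors of a point of `D` are exactly those of `f`, and then `step`
leaves one possible value at the point itself. -/
theorem eq_of_pair_mem (h : IsRecursion P H D f) {g : M} (hg : IsApprox P H g) {x : M} :
    x ∈ D → ∀ y : M, ZFSet.pair x.1 y.1 ∈ g.1 → y = f x := by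
  induction x using h.wf.induction with
  | _ x ih =>
    intro hx y hy
    refine (h.step x hx g (fun z hz w => ?_) y).1 (hg x y hy).1
    have hzD := h.mem_of_pred x hx z hz
    refine ⟨ih z hz hzD w, ?_⟩
    rintro rfl
    obtain ⟨w, hw⟩ := (hg x y hy).2 z hz
    exact ih z hz hzD w hw ▸ hw

/-- Conversely, a piece of the graph of `f` over `D` that is closed under predecessors satisfies the
recursion. -/
theorem isApprox (h : IsRecursion P H D f) {g : M}
    (hg : ∀ x y : M, ZFSet.pair x.1 y.1 ∈ g.1 → x ∈ D ∧ y = f x)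
    (hP : ∀ x y : M, ZFSet.pair x.1 y.1 ∈ g.1 → ∀ z, P z x → ZFSet.pair z.1 (f z).1 ∈ g.1) :
    IsApprox P H g := by
  intro x y hxy
  obtain ⟨hx, rfl⟩ := hg x y hxy
  refine ⟨(h.step x hx g (fun z hz w => ⟨fun hw => (hg z w hw).2, ?_⟩) _).2 rfl,
    fun z hz => ⟨f z, hP x _ hxy z hz⟩⟩
  rintro rfl
  exact hP x _ hxy z hz

theorem def_isApprox (hM : IsTransitiveModel M) (h : IsRecursion P H D f) :
    Def M fun g : M => IsApprox P H g := by
  refine Def.all (Def.all (Def.imp ?_ (Def.and ?_ (Def.all (Def.imp ?_ (Def.ex ?_))))))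
  · exact hM.def_pair_mem DefFun.id.fst.fst DefFun.id.fst.snd DefFun.id.snd
  · exact h.def_step.comp ((DefFun.id.fst.snd.prodMk DefFun.id.fst.fst).prodMk DefFun.id.snd)
  · exact h.def_pred.comp (DefFun.id.snd.prodMk DefFun.id.fst.fst.snd)
  · exact hM.def_pair_mem DefFun.id.fst.fst.fst.fst DefFun.id.fst.snd DefFun.id.snd

/-- `g` is the least approximation that is defined at `x`. -/
def IsLeastApprox (P : M → M → Prop) (H : M → M → M → Prop) (x g : M) : Prop :=
  (IsApprox P H g ∧ ∃ y : M, ZFSet.pair x.1 y.1 ∈ g.1) ∧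
    ∀ g' : M, (IsApprox P H g' ∧ ∃ y : M, ZFSet.pair x.1 y.1 ∈ g'.1) →
      ∀ p : M, p.1 ∈ g.1 → p.1 ∈ g'.1

theorem def_isApproxAt (hM : IsTransitiveModel M) (h : IsRecursion P H D f) :
    Def M fun p : M × M => IsApprox P H p.2 ∧ ∃ y : M, ZFSet.pair p.1.1 y.1 ∈ p.2.1 :=
  (h.def_isApprox hM).snd.and
    (.ex (hM.def_pair_mem DefFun.id.fst.snd DefFun.id.fst.fst DefFun.id.snd))

theorem def_isLeastApprox (hM : IsTransitiveModel M) (h : IsRecursion P H D f) :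
    Def M fun p : M × M => IsLeastApprox P H p.1 p.2 := by
  refine Def.and (h.def_isApproxAt hM) (Def.all (Def.imp ?_ (Def.all (Def.imp ?_ ?_))))
  · exact (h.def_isApproxAt hM).comp (DefFun.id.fst.fst.prodMk DefFun.id.snd)
  · exact Def.mem DefFun.id.snd DefFun.id.fst.fst.snd
  · exact Def.mem DefFun.id.snd DefFun.id.fst.snd

/-- Approximations at `x` are not unique, and replacement needs a unique one. The least one is cut
out of `g` by separation as the elements common to all approximations at `x`. It stays closed under
predecessors because any two approximations that contain the same pair over `D` also agree on its
predecessors. -/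
theorem exists_isLeastApprox (hM : IsTransitiveModel M) (h : IsRecursion P H D f) {x g : M}
    (hx : x ∈ D) (hg : ∀ x y : M, ZFSet.pair x.1 y.1 ∈ g.1 → x ∈ D ∧ y = f x)
    (hga : IsApprox P H g) (hxg : ZFSet.pair x.1 (f x).1 ∈ g.1) :
    ∃ g' : M, IsLeastApprox P H x g' ∧ ZFSet.pair x.1 (f x).1 ∈ g'.1 ∧
      ∀ x y : M, ZFSet.pair x.1 y.1 ∈ g'.1 → x ∈ D ∧ y = f x := by
  have hdef : Def M fun p : M => ∀ g' : M,
      (IsApprox P H g' ∧ ∃ y : M, ZFSet.pair x.1 y.1 ∈ g'.1) → p.1 ∈ g'.1 :=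
    .all (.imp ((h.def_isApproxAt hM).comp ((DefFun.const x).prodMk DefFun.id.snd))
      (Def.mem DefFun.id.fst DefFun.id.snd))
  obtain ⟨g', hg'⟩ := hM.exists_sep hdef g
  have hpair (a b : M) : ZFSet.pair a.1 b.1 ∈ g'.1 ↔ _ := hg' ⟨_, hM.pair_mem a.2 b.2⟩
  have hx' : ZFSet.pair x.1 (f x).1 ∈ g'.1 := by
    refine (hpair _ _).2 ⟨hxg, fun k hk => ?_⟩
    obtain ⟨hk, y, hy⟩ := hk
    exact h.eq_of_pair_mem hk hx y hy ▸ hy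
  have hnice (a b : M) (hab : ZFSet.pair a.1 b.1 ∈ g'.1) : a ∈ D ∧ b = f a :=
    hg a b ((hpair a b).1 hab).1
  refine ⟨g', ⟨⟨?_, _, hx'⟩, fun k hk p hp => ((hg' p).1 hp).2 k hk⟩, hx', hnice⟩
  refine h.isApprox hnice fun a b hab z hz => (hpair _ _).2 ?_
  have hzD := h.mem_of_pred a (hnice a b hab).1 z hz
  obtain ⟨h1, h2⟩ := (hpair a b).1 hab
  refine ⟨?_, fun k hk => ?_⟩
  · obtain ⟨w, hw⟩ := (hga a b h1).2 z hz
    exact h.eq_of_pair_mem hga hzD w hw ▸ hw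
  · obtain ⟨w, hw⟩ := (hk.1 a b (h2 k hk)).2 z hz
    exact h.eq_of_pair_mem hk.1 hzD w hw ▸ hw

theorem exists_approx (hM : IsTransitiveModel M) (h : IsRecursion P H D f) {x : M} :
    x ∈ D → ∃ g : M, (∀ x y : M, ZFSet.pair x.1 y.1 ∈ g.1 → x ∈ D ∧ y = f x) ∧
      IsApprox P H g ∧ ZFSet.pair x.1 (f x).1 ∈ g.1 := by
  induction x using h.wf.induction with
  | _ x ih =>
    intro hx
    have ih' (z : M) (hz : P z x) : ∃ g : M, IsLeastApprox P H z g ∧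
        ZFSet.pair z.1 (f z).1 ∈ g.1 ∧
          ∀ x y : M, ZFSet.pair x.1 y.1 ∈ g.1 → x ∈ D ∧ y = f x := by
      have hzD := h.mem_of_pred x hx z hz
      obtain ⟨g, h1, h2, h3⟩ := ih z hz hzD
      exact h.exists_isLeastApprox hM hzD h1 h2 h3
    obtain ⟨a, ha⟩ := h.bound x hx
    -- Two least approximations at `z` contain each other, so they are equal by extensionality and
    -- replacement collects them into one set.
    obtain ⟨S, hS⟩ := hM.exists_replace (R := fun z g => P z x ∧ IsLeastApprox P H z g)
      ((h.def_pred.comp (DefFun.id.fst.prodMk (.const x))).and (h.def_isLeastApprox hM)) a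
      (fun z _ g g' hg hg' => hM.ext fun p =>
        ⟨hg.2.2 g' hg'.2.1 p, hg'.2.2 g hg.2.1 p⟩)
    let q : M := ⟨_, hM.pair_mem x.2 (f x).2⟩
    -- The approximation at `x` is the union of the least approximations at its predecessors, with
    -- the single new pair `(x, f x)` added.
    let g : M := ⟨_, hM.union_mem (hM.sUnion_mem S.2) (hM.singleton_mem q.2)⟩
    have hg (p : M) : p.1 ∈ g.1 ↔ (∃ z k, P z x ∧ IsLeastApprox P H z k ∧ p.1 ∈ k.1) ∨ p = q := by
      simp only [g, ZFSet.mem_union, ZFSet.mem_sUnion, ZFSet.mem_singleton]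
      refine or_congr ⟨?_, ?_⟩ Subtype.ext_iff.symm
      · rintro ⟨k, hk, hp⟩
        obtain ⟨z, -, h1, h2⟩ := (hS ⟨k, hM.mem_of_mem S.2 hk⟩).1 hk
        exact ⟨z, _, h1, h2, hp⟩
      · rintro ⟨z, k, h1, h2, hp⟩
        exact ⟨k.1, (hS k).2 ⟨z, ha z h1, h1, h2⟩, hp⟩
    have hleast (z k : M) (hz : P z x) (hk : IsLeastApprox P H z k) :
        ZFSet.pair z.1 (f z).1 ∈ k.1 ∧
          ∀ x y : M, ZFSet.pair x.1 y.1 ∈ k.1 → x ∈ D ∧ y = f x := by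
      obtain ⟨k', h1, h2, h3⟩ := ih' z hz
      have e : k = k' := hM.ext fun p => ⟨hk.2 k' h1.1 p, h1.2 k hk.1 p⟩
      rw [e]
      exact ⟨h2, h3⟩
    have hq (a b : M) (hab : (⟨_, hM.pair_mem a.2 b.2⟩ : M) = q) : a = x ∧ b = f x := by
      have := ZFSet.pair_inj.1 (Subtype.ext_iff.1 hab)
      exact ⟨Subtype.ext this.1, Subtype.ext this.2⟩
    have hnice (a b : M) (hab : ZFSet.pair a.1 b.1 ∈ g.1) : a ∈ D ∧ b = f a := by
      rcases (hg ⟨_, hM.pair_mem a.2 b.2⟩).1 hab with ⟨z, k, hz, hk, hp⟩ | hp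
      · exact (hleast z k hz hk).2 a b hp
      · obtain ⟨rfl, rfl⟩ := hq a b hp
        exact ⟨hx, rfl⟩
    refine ⟨g, hnice, h.isApprox hnice fun a b hab z hz => ?_, (hg q).2 (.inr rfl)⟩
    refine (hg ⟨_, hM.pair_mem z.2 (f z).2⟩).2 (.inl ?_)
    have hzD := h.mem_of_pred a (hnice a b hab).1 z hz
    rcases (hg ⟨_, hM.pair_mem a.2 b.2⟩).1 hab with ⟨c, k, hc, hk, hp⟩ | hp
    · refine ⟨c, k, hc, hk, ?_⟩
      obtain ⟨w, hw⟩ := (hk.1.1 a b hp).2 z hz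
      exact h.eq_of_pair_mem hk.1.1 hzD w hw ▸ hw
    · obtain ⟨rfl, rfl⟩ := hq a b hp
      obtain ⟨k, h1, h2, -⟩ := ih' z hz
      exact ⟨z, k, hz, h1, h2⟩

/-- A function that is defined by recursion in `M` is definable over `M`. -/
theorem exists_def (hM : IsTransitiveModel M) (h : IsRecursion P H D f) :
    ∃ A : M → M → Prop, (Def M fun p : M × M => A p.1 p.2) ∧ ∀ x ∈ D, ∀ y, A x y ↔ y = f x := by
  refine ⟨fun x y => ∃ g : M, IsApprox P H g ∧ ZFSet.pair x.1 y.1 ∈ g.1,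
    .ex ((h.def_isApprox hM).snd.and
      (hM.def_pair_mem DefFun.id.snd DefFun.id.fst.fst DefFun.id.fst.snd)), fun x hx y => ?_⟩
  constructor
  · rintro ⟨g, hg, hy⟩
    exact h.eq_of_pair_mem hg hx y hy
  · rintro rfl
    obtain ⟨g, -, h1, h2⟩ := h.exists_approx hM hx
    exact ⟨g, h1, h2⟩

end IsRecursion

end StarForcing

end

noncomputable section

namespace StarForcing

open FirstOrder DefinableType

/-! ### Class Boolean algebras -/

theorem ClassBA.Elem.val_injective {B : ClassBA.{u}} :
    Function.Injective (ClassBA.Elem.val : B.Elem → ZFSet.{u}) :=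
  Subtype.val_injective

theorem ClassBA.exists_val_eq {B : ClassBA.{u}} {z : ZFSet.{u}} (hz : z ∈ B.carrier) :
    ∃ b : B.Elem, b.val = z :=
  ⟨(⟨z, hz⟩ : B.carrier), rfl⟩

theorem ClassBA.Elem.val_mem {B : ClassBA.{u}} (b : B.Elem) : b.val ∈ B.carrier :=
  Subtype.prop (p := (· ∈ B.carrier)) b

section

variable {M : Set ZFSet.{u}} {B : ClassBA.{u}} [hB : Fact (IsCompleteClassBA M B)]
  {α : Type*} [DefinableType M α]

/-- The element of `M` that an element of a class Boolean algebra is. -/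
def toModel (M : Set ZFSet.{u}) {B : ClassBA.{u}} [hB : Fact (IsCompleteClassBA M B)]
    (b : B.Elem) : M :=
  ⟨b.val, hB.out.subset b.val_mem⟩

theorem toModel_injective : Function.Injective (toModel M : B.Elem → M) := fun _ _ h =>
  ClassBA.Elem.val_injective (congrArg (Subtype.val (p := (· ∈ M))) h)

/-- Definability of the carrier is what allows formulas over `M` to quantify over `B`, even if `B`
is a proper class. -/
instance instDefinableTypeElem : DefinableType M B.Elem where
  ι := Unit
  finite := inferInstance
  enc b _ := toModel M b
  enc_injective _ _ h := toModel_injective (M := M) (congrFun h ())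
  definable_range := by
    refine definable_of_subset_of_subset
      (hB.out.definable_carrier.preimage_comp (fun _ : Fin 1 => ())) ?_ ?_
    · rintro _ ⟨b, rfl⟩
      exact b.val_mem
    · intro v hv
      obtain ⟨b, hb⟩ := B.exists_val_eq hv
      exact ⟨b, funext fun _ => Subtype.ext hb⟩

theorem DefFun.toModel {f : α → B.Elem} (hf : DefFun M f) :
    DefFun M fun a => toModel M (f a) :=
  DefFun.comp (g := fun b : B.Elem => StarForcing.toModel M b)
    (.of_graph <| (Def.eq_snd_fst (M := M) (α := M)).reindex
      (fun p : B.Elem × M => (StarForcing.toModel M p.1, p.2)) id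
        fun p => funext fun i => by rcases i with i | i <;> rfl) hf

namespace Def

theorem le {f g : α → B.Elem} (hf : DefFun M f) (hg : DefFun M g) :
    Def M fun a => f a ≤ g a := by
  refine ((of_definable₂ hB.out.definable_le).comp (hf.toModel.prodMk hg.toModel)).congr
    fun a => ?_
  constructor
  · intro h
    exact ⟨f a, g a, rfl, rfl, h⟩
  · rintro ⟨b, c, hb, hc, h⟩
    rwa [ClassBA.Elem.val_injective hb, ClassBA.Elem.val_injective hc] at h

theorem isLUB {S : α → B.Elem → Prop} (hS : Def M fun p : α × B.Elem => S p.1 p.2)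
    {f : α → B.Elem} (hf : DefFun M f) : Def M fun a => IsLUB {d | S a d} (f a) := by
  have hS' : Def M fun p : (α × B.Elem) × B.Elem => S p.1.1 p.2 :=
    hS.comp (DefFun.id.fst.fst.prodMk DefFun.id.snd)
  exact and (all (hS.imp (le DefFun.id.snd (hf.comp DefFun.id.fst))))
    (all (imp (all (hS'.imp (le DefFun.id.snd DefFun.id.fst.snd)))
      (le (hf.comp DefFun.id.fst) DefFun.id.snd)))

theorem isGLB {S : α → B.Elem → Prop} (hS : Def M fun p : α × B.Elem => S p.1 p.2)
    {f : α → B.Elem} (hf : DefFun M f) : Def M fun a => IsGLB {d | S a d} (f a) := by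
  have hS' : Def M fun p : (α × B.Elem) × B.Elem => S p.1.1 p.2 :=
    hS.comp (DefFun.id.fst.fst.prodMk DefFun.id.snd)
  exact and (all (hS.imp (le (hf.comp DefFun.id.fst) DefFun.id.snd)))
    (all (imp (all (hS'.imp (le DefFun.id.fst.snd DefFun.id.snd)))
      (le DefFun.id.snd (hf.comp DefFun.id.fst))))

end Def

namespace DefFun

/-- Only the order of `B` is given as definable. Meet and join are recovered from it as bounds of a
two-element set, and then the complement through its two defining equations. -/
theorem inf {f g : α → B.Elem} (hf : DefFun M f) (hg : DefFun M g) :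
    DefFun M fun a => f a ⊓ g a :=
  .of_graph <| (Def.isGLB (S := fun (p : α × B.Elem) d => d = f p.1 ∨ d = g p.1)
    ((Def.eq DefFun.id.snd (hf.comp DefFun.id.fst.fst)).or
      (Def.eq DefFun.id.snd (hg.comp DefFun.id.fst.fst))) DefFun.id.snd).congr fun _ =>
    ⟨fun h => h ▸ isGLB_pair, fun h => h.unique isGLB_pair⟩

theorem sup {f g : α → B.Elem} (hf : DefFun M f) (hg : DefFun M g) :
    DefFun M fun a => f a ⊔ g a :=
  .of_graph <| (Def.isLUB (S := fun (p : α × B.Elem) d => d = f p.1 ∨ d = g p.1)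
    ((Def.eq DefFun.id.snd (hf.comp DefFun.id.fst.fst)).or
      (Def.eq DefFun.id.snd (hg.comp DefFun.id.fst.fst))) DefFun.id.snd).congr fun _ =>
    ⟨fun h => h ▸ isLUB_pair, fun h => h.unique isLUB_pair⟩

theorem compl {f : α → B.Elem} (hf : DefFun M f) : DefFun M fun a => (f a)ᶜ :=
  .of_graph <| ((Def.eq (DefFun.id.snd.inf (hf.comp DefFun.id.fst)) (.const ⊥)).and
    (Def.eq (DefFun.id.snd.sup (hf.comp DefFun.id.fst)) (.const ⊤))).congr fun p => by
      rw [eq_compl_iff_isCompl, isCompl_iff, disjoint_iff, codisjoint_iff]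

end DefFun

-- Subsets of the algebra that lie in `M`, and their bounds

/-- The subset `S` of the class Boolean algebra is an element of `M`. -/
def IsSetIn (M : Set ZFSet.{u}) {B : ClassBA.{u}} (S : Set B.Elem) : Prop :=
  ∃ X ∈ M, ∀ z, z ∈ X ↔ ∃ d ∈ S, d.val = z

-- De Morgan's law without assuming that bounds exist. It transfers completeness, given for suprema
-- only, to infima.
omit hB in
theorem isLUB_preimage_compl {S : Set B.Elem} {s : B.Elem} :
    IsLUB {d | dᶜ ∈ S} sᶜ ↔ IsGLB S s := by
  constructor
  · intro h
    refine ⟨fun d hd => ?_, fun u hu => ?_⟩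
    · exact compl_le_compl_iff_le.1 (h.1 (by simpa using hd))
    · refine compl_le_compl_iff_le.1 (h.2 fun d hd => ?_)
      exact le_compl_comm.1 (hu hd)
  · intro h
    refine ⟨fun d hd => le_compl_comm.1 (h.1 hd), fun u hu => ?_⟩
    refine compl_le_of_compl_le (h.2 fun d hd => ?_)
    exact compl_le_of_compl_le (hu (by simpa using hd))

namespace IsSetIn

/-- This is replacement with values in `B`, and the source of every set of Boolean values used
below. The relation may be partial on `a`. -/
theorem of_rel (hM : IsTransitiveModel M) {R : M → B.Elem → Prop}
    (hR : Def M fun p : M × B.Elem => R p.1 p.2) (a : M)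
    (hfun : ∀ t : M, t.1 ∈ a.1 → ∀ d d', R t d → R t d' → d = d') :
    IsSetIn M {d | ∃ t : M, t.1 ∈ a.1 ∧ R t d} := by
  have hR' : Def M fun p : (M × M) × B.Elem => R p.1.1 p.2 ∧ p.1.2 = toModel M p.2 :=
    (hR.comp (DefFun.id.fst.fst.prodMk DefFun.id.snd)).and
      (Def.eq DefFun.id.fst.snd DefFun.id.snd.toModel)
  obtain ⟨X, hX⟩ := hM.exists_replace (R := fun t y => ∃ d : B.Elem, R t d ∧ y = toModel M d)
    (Def.ex hR') a (by
      rintro t ht _ _ ⟨d, hd, rfl⟩ ⟨d', hd', rfl⟩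
      rw [hfun t ht d d' hd hd'])
  refine ⟨X.1, X.2, fun z => ⟨fun hz => ?_, ?_⟩⟩
  · obtain ⟨t, ht, d, hd, h⟩ := (hX ⟨z, hM.mem_of_mem X.2 hz⟩).1 hz
    exact ⟨d, ⟨t, ht, hd⟩, (Subtype.ext_iff.1 h).symm⟩
  · rintro ⟨d, ⟨t, ht, hd⟩, rfl⟩
    exact (hX (toModel M d)).2 ⟨t, ht, d, hd, rfl⟩

theorem preimage_compl (hM : IsTransitiveModel M) {S : Set B.Elem} (hS : IsSetIn M S) :
    IsSetIn M {d | dᶜ ∈ S} := by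
  obtain ⟨X, hX, h⟩ := hS
  convert of_rel hM (R := fun (t : M) (d : B.Elem) => t = toModel M dᶜ)
    (Def.eq DefFun.id.fst DefFun.id.snd.compl.toModel) ⟨X, hX⟩ (by
      rintro t _ d d' rfl hd
      exact compl_injective (toModel_injective hd)) using 1
  ext d
  constructor
  · intro hd
    exact ⟨_, (h _).2 ⟨_, hd, rfl⟩, rfl⟩
  · rintro ⟨_, hd, rfl⟩
    obtain ⟨e, he, h'⟩ := (h _).1 hd
    have e' : e = dᶜ := ClassBA.Elem.val_injective h'
    rwa [e'] at he

theorem exists_isLUB {S : Set B.Elem} (hS : IsSetIn M S) : ∃ s, IsLUB S s := by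
  obtain ⟨X, hX, h⟩ := hS
  have e : S = {b : B.Elem | b.val ∈ X} := by
    ext b
    refine ⟨fun hb => (h _).2 ⟨b, hb, rfl⟩, fun hb => ?_⟩
    obtain ⟨c, hc, h'⟩ := (h _).1 hb
    exact ClassBA.Elem.val_injective h' ▸ hc
  rw [e]
  refine hB.out.complete X hX fun z hz => ?_
  obtain ⟨d, -, rfl⟩ := (h z).1 hz
  exact d.val_mem

theorem exists_isGLB (hM : IsTransitiveModel M) {S : Set B.Elem} (hS : IsSetIn M S) :
    ∃ s, IsGLB S s := by
  obtain ⟨s, hs⟩ := (hS.preimage_compl hM).exists_isLUB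
  exact ⟨sᶜ, isLUB_preimage_compl.1 (by simpa using hs)⟩

end IsSetIn

end

-- Sums and products in the ultrafilter

section

variable {M : Set ZFSet.{u}} {B : ClassBA.{u}} {S : Set B.Elem}

theorem isLUB_bSum (h : ∃ s, IsLUB S s) : IsLUB S (bSum S) := by
  rw [bSum, dif_pos h]
  exact h.choose_spec

theorem isGLB_bProd (h : ∃ s, IsGLB S s) : IsGLB S (bProd S) := by
  rw [bProd, dif_pos h]
  exact h.choose_spec

namespace IsCompleteUltrafilter

variable {G : Set B.Elem} (hG : IsCompleteUltrafilter M B G)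
include hG

theorem compl_mem_iff {a : B.Elem} : aᶜ ∈ G ↔ a ∉ G := by
  refine ⟨fun h h' => hG.bot_notMem ?_, fun h => (hG.mem_or_compl_mem a).resolve_left h⟩
  simpa using hG.inf_mem _ _ h' h

theorem inf_mem_iff {a b : B.Elem} : a ⊓ b ∈ G ↔ a ∈ G ∧ b ∈ G :=
  ⟨fun h => ⟨hG.mem_of_le _ _ h inf_le_left, hG.mem_of_le _ _ h inf_le_right⟩,
    fun h => hG.inf_mem _ _ h.1 h.2⟩

theorem compl_sup_mem_iff {a b : B.Elem} : aᶜ ⊔ b ∈ G ↔ (a ∈ G → b ∈ G) := by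
  have h : aᶜ ⊔ b = (a ⊓ bᶜ)ᶜ := by simp
  rw [h, hG.compl_mem_iff, hG.inf_mem_iff, hG.compl_mem_iff]
  tauto

theorem isLUB_mem_iff (hS : IsSetIn M S) {s : B.Elem} (hs : IsLUB S s) :
    s ∈ G ↔ ∃ d ∈ S, d ∈ G := by
  refine ⟨fun h => ?_, fun ⟨d, hd, hdG⟩ => hG.mem_of_le _ _ hdG (hs.1 hd)⟩
  obtain ⟨X, hX, hXS⟩ := hS
  have e : {b : B.Elem | b.val ∈ X} = S := by
    ext b
    refine ⟨fun hb => ?_, fun hb => (hXS _).2 ⟨b, hb, rfl⟩⟩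
    obtain ⟨c, hc, h'⟩ := (hXS _).1 hb
    exact ClassBA.Elem.val_injective h' ▸ hc
  obtain ⟨b, hb, hbX⟩ := hG.complete X hX (fun z hz => by
    obtain ⟨d, -, rfl⟩ := (hXS z).1 hz
    exact d.val_mem) s h (e ▸ hs)
  exact ⟨b, e ▸ hbX, hb⟩

theorem bSum_mem_iff [Fact (IsCompleteClassBA M B)] (hS : IsSetIn M S) :
    bSum S ∈ G ↔ ∃ d ∈ S, d ∈ G :=
  hG.isLUB_mem_iff hS (isLUB_bSum hS.exists_isLUB)

/-- If the product is not in `G`, its complement is, and that is the sum of the complements of the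
factors; completeness of `G` then yields a factor outside `G`. -/
theorem bProd_mem_iff [Fact (IsCompleteClassBA M B)] (hM : IsTransitiveModel M)
    (hS : IsSetIn M S) : bProd S ∈ G ↔ ∀ d ∈ S, d ∈ G := by
  have h := hG.isLUB_mem_iff (hS.preimage_compl hM)
    (isLUB_preimage_compl.2 (isGLB_bProd (hS.exists_isGLB hM)))
  rw [hG.compl_mem_iff] at h
  rw [← not_iff_not, h]
  push Not
  constructor
  · rintro ⟨d, hd, hdG⟩
    exact ⟨_, hd, fun h => hG.compl_mem_iff.1 h hdG⟩
  · rintro ⟨d, hd, hdG⟩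
    exact ⟨dᶜ, by simpa using hd, hG.compl_mem_iff.2 hdG⟩

end IsCompleteUltrafilter

end

end StarForcing

end

noncomputable section

namespace StarForcing

open FirstOrder DefinableType

/-! ### Names and the definability of their Boolean values -/

theorem kpair_rank (x y : ZFSet.{u}) :
    (ZFSet.pair x y).rank = Order.succ (Order.succ (max x.rank y.rank)) := by
  rw [ZFSet.pair, ZFSet.rank_pair, ZFSet.rank_singleton, ZFSet.rank_pair, ← Order.succ_max,
    ← Order.succ_max, max_eq_right (Order.succ_le_succ (le_max_left _ _))]

theorem left_mem_sUnion_sUnion {x y z : ZFSet.{u}} (h : ZFSet.pair x y ∈ z) :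
    x ∈ ZFSet.sUnion (ZFSet.sUnion z) :=
  ZFSet.mem_sUnion.2 ⟨{x, y}, ZFSet.mem_sUnion.2 ⟨_, h, by simp [ZFSet.pair]⟩, by simp⟩

theorem right_mem_sUnion_sUnion {x y z : ZFSet.{u}} (h : ZFSet.pair x y ∈ z) :
    y ∈ ZFSet.sUnion (ZFSet.sUnion z) :=
  ZFSet.mem_sUnion.2 ⟨{x, y}, ZFSet.mem_sUnion.2 ⟨_, h, by simp [ZFSet.pair]⟩, by simp⟩

theorem mem_dom_of_mem {x t b : ZFSet.{u}} (h : ZFSet.pair t b ∈ x) : t ∈ dom x := ⟨b, h⟩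

/-- A Kuratowski pair of elements of `c` lies in the double power set of `c`. Only an upper bound
for the product is needed. -/
theorem IsTransitiveModel.exists_prod {M : Set ZFSet.{u}} (hM : IsTransitiveModel M) (c : M) :
    ∃ a : M, ∀ t ∈ c.1, ∀ s ∈ c.1, ZFSet.pair t s ∈ a.1 := by
  obtain ⟨a, ha⟩ := hM.exists_powerset c
  obtain ⟨b, hb⟩ := hM.exists_powerset a
  refine ⟨b, fun t ht s hs => ?_⟩
  have htM := hM.mem_of_mem c.2 ht
  have hsM := hM.mem_of_mem c.2 hs
  refine hb ⟨_, hM.pair_mem htM hsM⟩ fun w hw => ?_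
  rcases ZFSet.mem_pair.1 hw with rfl | rfl
  · exact ha ⟨_, hM.singleton_mem htM⟩ (by intro w hw; rw [ZFSet.mem_singleton.1 hw]; exact ht)
  · refine ha ⟨_, hM.unordered_mem htM hsM⟩ fun w hw => ?_
    rcases ZFSet.mem_pair.1 hw with rfl | rfl <;> assumption

section

variable {M : Set ZFSet.{u}} {B : ClassBA.{u}} {x t : ZFSet.{u}}

theorem mem_of_mem_names (hx : x ∈ names M B) : x ∈ M := by
  obtain ⟨-, -, -, h, -⟩ := hx
  exact h

theorem mem_names_of_mem_dom (hM : IsTransitiveModel M) (hx : x ∈ names M B) (ht : t ∈ dom x) :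
    t ∈ names M B := by
  obtain ⟨α, h1, h2, h3, ⟨_, _, _, h4⟩⟩ := hx
  have h5 := ht
  obtain ⟨b, hb⟩ := ht
  exact ⟨α, h1, h2, hM.left_mem (hM.mem_of_mem h3 hb), h4 t h5⟩

theorem exists_pair_mem (hx : x ∈ names M B) (ht : t ∈ dom x) :
    ∃ b : B.Elem, ZFSet.pair t b.val ∈ x := by
  obtain ⟨α, h1, h2, h3, ⟨_, h4, _, _⟩⟩ := hx
  obtain ⟨b, hb⟩ := ht
  obtain ⟨t', b', hb', e⟩ := h4 _ hb
  obtain ⟨rfl, rfl⟩ := ZFSet.pair_inj.1 e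
  obtain ⟨c, rfl⟩ := B.exists_val_eq hb'.1
  exact ⟨c, hb⟩

/-- A name is a function, so the choice made in `starMem` has only one candidate. -/
theorem starMem_eq (hx : x ∈ names M B) {b : B.Elem} (h : ZFSet.pair t b.val ∈ x) :
    starMem t x = b := by
  have h' : ∃ b : B.Elem, ZFSet.pair t b.val ∈ x := ⟨b, h⟩
  obtain ⟨α, _, _, _, ⟨_, _, hfun, _⟩⟩ := hx
  rw [starMem, dif_pos h']
  exact ClassBA.Elem.val_injective (hfun _ _ _ h'.choose_spec h)

theorem pair_starMem_mem (hx : x ∈ names M B) (ht : t ∈ dom x) :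
    ZFSet.pair t (starMem t x : B.Elem).val ∈ x := by
  obtain ⟨b, hb⟩ := exists_pair_mem hx ht
  rwa [starMem_eq hx hb]

theorem valMem_eq (x y : ZFSet.{u}) :
    (valMem x y : B.Elem) = bSum {c | ∃ t ∈ dom y, c = valEq x t ⊓ starMem t y} := by
  rw [valMem]
  simp only [exists_prop]

theorem valEq_eq (x y : ZFSet.{u}) :
    (valEq x y : B.Elem) = bProd {c | ∃ t ∈ dom x, c = (starMem t x)ᶜ ⊔ valMem t y} ⊓
      bProd {c | ∃ t ∈ dom y, c = (starMem t y)ᶜ ⊔ valMem t x} := by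
  rw [valEq]
  simp only [exists_prop]

end

variable {M : Set ZFSet.{u}} {B : ClassBA.{u}} {α : Type*} [DefinableType M α]

/-- `c = ∑ {e · b | (s, b) ∈ y, E t s e}`. -/
def IsValMem (E : M → M → B.Elem → Prop) (t y : M) (c : B.Elem) : Prop :=
  IsLUB {d | ∃ (s : M) (b e : B.Elem), ZFSet.pair s.1 b.val ∈ y.1 ∧ E t s e ∧ d = e ⊓ b} c

/-- `c = ∏ {-a + m | (t, a) ∈ x, IsValMem E t y m}`. -/
def IsValSubset (E : M → M → B.Elem → Prop) (x y : M) (c : B.Elem) : Prop :=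
  IsGLB {d | ∃ (t : M) (a m : B.Elem),
    ZFSet.pair t.1 a.val ∈ x.1 ∧ IsValMem E t y m ∧ d = aᶜ ⊔ m} c

variable [hB : Fact (IsCompleteClassBA M B)]

theorem Def.pair_val_mem (hM : IsTransitiveModel M) {f g : α → M} {k : α → B.Elem}
    (hf : DefFun M f) (hg : DefFun M g) (hk : DefFun M k) :
    Def M fun a => ZFSet.pair (g a).1 (k a).val ∈ (f a).1 :=
  hM.def_pair_mem (k := fun a => toModel M (k a)) hf hg hk.toModel

theorem Def.isValMem (hM : IsTransitiveModel M) {E : α → M → M → B.Elem → Prop}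
    (hE : Def M fun q : ((α × M) × M) × B.Elem => E q.1.1.1 q.1.1.2 q.1.2 q.2)
    {t y : α → M} {c : α → B.Elem} (ht : DefFun M t) (hy : DefFun M y) (hc : DefFun M c) :
    Def M fun a => IsValMem (E a) (t a) (y a) (c a) := by
  refine Def.isLUB ?_ hc
  iterate 3 refine Def.ex ?_
  refine Def.and ?_ (Def.and ?_ ?_)
  · exact Def.pair_val_mem hM (hy.comp DefFun.id.fst.fst.fst.fst) DefFun.id.fst.fst.snd
      DefFun.id.fst.snd
  · exact hE.comp (((DefFun.id.fst.fst.fst.fst.prodMk (ht.comp DefFun.id.fst.fst.fst.fst)).prodMk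
      DefFun.id.fst.fst.snd).prodMk DefFun.id.snd)
  · exact Def.eq DefFun.id.fst.fst.fst.snd (DefFun.id.snd.inf DefFun.id.fst.snd)

theorem Def.isValSubset (hM : IsTransitiveModel M) {E : α → M → M → B.Elem → Prop}
    (hE : Def M fun q : ((α × M) × M) × B.Elem => E q.1.1.1 q.1.1.2 q.1.2 q.2)
    {x y : α → M} {c : α → B.Elem} (hx : DefFun M x) (hy : DefFun M y) (hc : DefFun M c) :
    Def M fun a => IsValSubset (E a) (x a) (y a) (c a) := by
  refine Def.isGLB ?_ hc
  iterate 3 refine Def.ex ?_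
  refine Def.and ?_ (Def.and ?_ ?_)
  · exact Def.pair_val_mem hM (hx.comp DefFun.id.fst.fst.fst.fst) DefFun.id.fst.fst.snd
      DefFun.id.fst.snd
  · refine Def.isValMem hM (E := fun p : (((α × B.Elem) × M) × B.Elem) × B.Elem =>
      E p.1.1.1.1) ?_ DefFun.id.fst.fst.snd (hy.comp DefFun.id.fst.fst.fst.fst) DefFun.id.snd
    exact hE.comp (((DefFun.id.fst.fst.fst.fst.fst.fst.fst.prodMk DefFun.id.fst.fst.snd).prodMk
      DefFun.id.fst.snd).prodMk DefFun.id.snd)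
  · exact Def.eq DefFun.id.fst.fst.fst.snd (DefFun.id.fst.snd.compl.sup DefFun.id.snd)

/-- The domain of `y` is contained in `⋃ ⋃ y`, to which replacement is applied. The relation `R` is
controlled only on the domain, so membership in the domain is added to it. -/
theorem isSetIn_image_dom (hM : IsTransitiveModel M) {y : M} {R : M → B.Elem → Prop}
    (hR : Def M fun p : M × B.Elem => R p.1 p.2) {v : ZFSet.{u} → B.Elem}
    (h : ∀ s : M, s.1 ∈ dom y.1 → ∀ d, R s d ↔ d = v s.1) :
    IsSetIn M {d | ∃ s ∈ dom y.1, d = v s} := by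
  have hR' : Def M fun p : M × B.Elem => (∃ b : M, ZFSet.pair p.1.1 b.1 ∈ y.1) ∧ R p.1 p.2 :=
    .and (.ex (hM.def_pair_mem (.const y) DefFun.id.fst.fst DefFun.id.snd)) hR
  convert IsSetIn.of_rel hM (R := fun t d => (∃ b : M, ZFSet.pair t.1 b.1 ∈ y.1) ∧ R t d) hR'
    ⟨_, hM.sUnion_mem (hM.sUnion_mem y.2)⟩ ?_ using 1
  · ext d
    constructor
    · rintro ⟨s, ⟨b, hb⟩, rfl⟩
      have hs := hM.mem_of_mem y.2 hb
      exact ⟨⟨s, hM.left_mem hs⟩, left_mem_sUnion_sUnion hb, ⟨⟨b, hM.right_mem hs⟩, hb⟩,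
        (h ⟨s, hM.left_mem hs⟩ ⟨b, hb⟩ _).2 rfl⟩
    · rintro ⟨s, -, ⟨b, hb⟩, hd⟩
      exact ⟨s.1, ⟨b.1, hb⟩, (h s ⟨b.1, hb⟩ d).1 hd⟩
  · rintro s - d d' ⟨⟨b, hb⟩, hd⟩ ⟨-, hd'⟩
    rw [(h s ⟨b.1, hb⟩ d).1 hd, (h s ⟨b.1, hb⟩ d').1 hd']

-- Boolean values computed from a relation that represents equality

section

variable {E : M → M → B.Elem → Prop} (hM : IsTransitiveModel M)
  (hE : Def M fun p : (M × M) × B.Elem => E p.1.1 p.1.2 p.2)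

include hM in
omit hB in
theorem isValMem_set_eq {t y : M} (hy : y.1 ∈ names M B)
    (h : ∀ s : M, s.1 ∈ dom y.1 → ∀ e, E t s e ↔ e = valEq t.1 s.1) :
    {d | ∃ (s : M) (b e : B.Elem), ZFSet.pair s.1 b.val ∈ y.1 ∧ E t s e ∧ d = e ⊓ b} =
      {c : B.Elem | ∃ s ∈ dom y.1, c = valEq t.1 s ⊓ starMem s y.1} := by
  ext d
  constructor
  · rintro ⟨s, b, e, hb, he, rfl⟩
    exact ⟨s.1, ⟨_, hb⟩, by rw [(h s ⟨_, hb⟩ e).1 he, starMem_eq hy hb]⟩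
  · rintro ⟨s, hs, rfl⟩
    have hs' := mem_of_mem_names (mem_names_of_mem_dom hM hy hs)
    exact ⟨⟨s, hs'⟩, starMem s y.1, valEq t.1 s, pair_starMem_mem hy hs, (h ⟨s, hs'⟩ hs _).2 rfl,
      rfl⟩

include hM hE in
theorem isSetIn_valMem {t y : M} (hy : y.1 ∈ names M B)
    (h : ∀ s : M, s.1 ∈ dom y.1 → ∀ e, E t s e ↔ e = valEq t.1 s.1) :
    IsSetIn M {c : B.Elem | ∃ s ∈ dom y.1, c = valEq t.1 s ⊓ starMem s y.1} := by
  refine isSetIn_image_dom hM (v := fun s => valEq t.1 s ⊓ starMem s y.1) (R := fun s d =>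
    ∃ b e : B.Elem, ZFSet.pair s.1 b.val ∈ y.1 ∧ E t s e ∧ d = e ⊓ b) ?_ fun s hs d => ?_
  · iterate 2 refine Def.ex ?_
    refine Def.and ?_ (Def.and ?_ ?_)
    · exact Def.pair_val_mem hM (.const y) DefFun.id.fst.fst.fst DefFun.id.fst.snd
    · exact hE.comp (((DefFun.const t).prodMk DefFun.id.fst.fst.fst).prodMk DefFun.id.snd)
    · exact Def.eq DefFun.id.fst.fst.snd (DefFun.id.snd.inf DefFun.id.fst.snd)
  · constructor
    · rintro ⟨b, e, hb, he, rfl⟩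
      rw [(h s hs e).1 he, starMem_eq hy hb]
    · rintro rfl
      exact ⟨_, _, pair_starMem_mem hy hs, (h s hs _).2 rfl, rfl⟩

include hM hE in
theorem isValMem_iff {t y : M} (hy : y.1 ∈ names M B)
    (h : ∀ s : M, s.1 ∈ dom y.1 → ∀ e, E t s e ↔ e = valEq t.1 s.1) (c : B.Elem) :
    IsValMem E t y c ↔ c = valMem t.1 y.1 := by
  have hs := isLUB_bSum (isSetIn_valMem hM hE hy h).exists_isLUB
  rw [IsValMem, isValMem_set_eq hM hy h, valMem_eq]
  exact ⟨fun h => h.unique hs, fun h => h ▸ hs⟩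

include hM hE in
theorem isSetIn_valSubset {x y : M} (hx : x.1 ∈ names M B) (hy : y.1 ∈ names M B)
    (h : ∀ t s : M, t.1 ∈ dom x.1 → s.1 ∈ dom y.1 → ∀ e, E t s e ↔ e = valEq t.1 s.1) :
    IsSetIn M {c : B.Elem | ∃ t ∈ dom x.1, c = (starMem t x.1)ᶜ ⊔ valMem t y.1} := by
  refine isSetIn_image_dom hM (v := fun t => (starMem t x.1)ᶜ ⊔ valMem t y.1) (R := fun t d =>
    ∃ a m : B.Elem, ZFSet.pair t.1 a.val ∈ x.1 ∧ IsValMem E t y m ∧ d = aᶜ ⊔ m) ?_ fun t ht d => ?_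
  · iterate 2 refine Def.ex ?_
    refine Def.and ?_ (Def.and ?_ ?_)
    · exact Def.pair_val_mem hM (.const x) DefFun.id.fst.fst.fst DefFun.id.fst.snd
    · exact Def.isValMem hM (E := fun _ => E)
        (hE.comp ((DefFun.id.fst.fst.snd.prodMk DefFun.id.fst.snd).prodMk DefFun.id.snd))
        DefFun.id.fst.fst.fst (.const y) DefFun.id.snd
    · exact Def.eq DefFun.id.fst.fst.snd (DefFun.id.fst.snd.compl.sup DefFun.id.snd)
  · constructor
    · rintro ⟨a, m, ha, hm, rfl⟩
      rw [(isValMem_iff hM hE hy (fun s => h t s ht) m).1 hm, starMem_eq hx ha]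
    · rintro rfl
      exact ⟨_, _, pair_starMem_mem hx ht, (isValMem_iff hM hE hy (fun s => h t s ht) _).2 rfl, rfl⟩

include hM hE in
theorem isValSubset_iff {x y : M} (hx : x.1 ∈ names M B) (hy : y.1 ∈ names M B)
    (h : ∀ t s : M, t.1 ∈ dom x.1 → s.1 ∈ dom y.1 → ∀ e, E t s e ↔ e = valEq t.1 s.1)
    (c : B.Elem) : IsValSubset E x y c ↔
      c = bProd {c : B.Elem | ∃ t ∈ dom x.1, c = (starMem t x.1)ᶜ ⊔ valMem t y.1} := by
  have hs := isGLB_bProd ((isSetIn_valSubset hM hE hx hy h).exists_isGLB hM)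
  have e : {d | ∃ (t : M) (a m : B.Elem), ZFSet.pair t.1 a.val ∈ x.1 ∧ IsValMem E t y m ∧
      d = aᶜ ⊔ m} = {c : B.Elem | ∃ t ∈ dom x.1, c = (starMem t x.1)ᶜ ⊔ valMem t y.1} := by
    ext d
    constructor
    · rintro ⟨t, a, m, ha, hm, rfl⟩
      refine ⟨t.1, ⟨_, ha⟩, ?_⟩
      rw [(isValMem_iff hM hE hy (fun s => h t s ⟨_, ha⟩) m).1 hm, starMem_eq hx ha]
    · rintro ⟨t, ht, rfl⟩
      have ht' := mem_of_mem_names (mem_names_of_mem_dom hM hx ht)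
      exact ⟨⟨t, ht'⟩, _, _, pair_starMem_mem hx ht,
        (isValMem_iff hM hE hy (fun s => h ⟨t, ht'⟩ s ht) _).2 rfl, rfl⟩
  rw [IsValSubset, e]
  exact ⟨fun h => h.unique hs, fun h => h ▸ hs⟩

end

-- The recursion for equality of names

/-- `z` codes a pair, in either order, of an element of `dom x` and an element of `dom y`, where
`p` codes the pair of `x` and `y`. -/
def PairPred (z p : M) : Prop :=
  ∃ x y t s a b : M, p.1 = ZFSet.pair x.1 y.1 ∧ ZFSet.pair t.1 a.1 ∈ x.1 ∧
    ZFSet.pair s.1 b.1 ∈ y.1 ∧ (z.1 = ZFSet.pair t.1 s.1 ∨ z.1 = ZFSet.pair s.1 t.1)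

/-- The relation on `t`, `s`, `e` that the set `g` of pairs `((t, s), e)` codes. -/
def pairRel (g t s : M) (e : B.Elem) : Prop :=
  ∃ q : M, q.1 = ZFSet.pair t.1 s.1 ∧ ZFSet.pair q.1 e.val ∈ g.1

/-- The recursion step for `‖x = y‖`. -/
def ValEqStep (B : ClassBA.{u}) [Fact (IsCompleteClassBA M B)] (p g v : M) : Prop :=
  ∃ (x y : M) (c c' : B.Elem), p.1 = ZFSet.pair x.1 y.1 ∧ IsValSubset (pairRel g) x y c ∧
    IsValSubset (pairRel g) y x c' ∧ v = toModel M (c ⊓ c')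

theorem def_pairRel (hM : IsTransitiveModel M) {g t s : α → M} {e : α → B.Elem}
    (hg : DefFun M g) (ht : DefFun M t) (hs : DefFun M s) (he : DefFun M e) :
    Def M fun a => pairRel (g a) (t a) (s a) (e a) := by
  refine Def.ex (Def.and ?_ ?_)
  · exact hM.def_eq_pair DefFun.id.snd (ht.comp DefFun.id.fst) (hs.comp DefFun.id.fst)
  · exact Def.pair_val_mem hM (hg.comp DefFun.id.fst) DefFun.id.snd (he.comp DefFun.id.fst)

theorem def_pairPred (hM : IsTransitiveModel M) :
    Def M fun p : M × M => PairPred p.1 p.2 := by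
  iterate 6 refine Def.ex ?_
  refine Def.and ?_ (Def.and ?_ (Def.and ?_ (Def.or ?_ ?_)))
  · exact hM.def_eq_pair DefFun.id.fst.fst.fst.fst.fst.fst.snd DefFun.id.fst.fst.fst.fst.fst.snd
      DefFun.id.fst.fst.fst.fst.snd
  · exact hM.def_pair_mem DefFun.id.fst.fst.fst.fst.fst.snd DefFun.id.fst.fst.fst.snd
      DefFun.id.fst.snd
  · exact hM.def_pair_mem DefFun.id.fst.fst.fst.fst.snd DefFun.id.fst.fst.snd
      DefFun.id.snd
  · exact hM.def_eq_pair DefFun.id.fst.fst.fst.fst.fst.fst.fst DefFun.id.fst.fst.fst.snd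
      DefFun.id.fst.fst.snd
  · exact hM.def_eq_pair DefFun.id.fst.fst.fst.fst.fst.fst.fst DefFun.id.fst.fst.snd
      DefFun.id.fst.fst.fst.snd

theorem def_valEqStep (hM : IsTransitiveModel M) :
    Def M fun p : (M × M) × M => ValEqStep B p.1.1 p.1.2 p.2 := by
  iterate 4 refine Def.ex ?_
  refine Def.and ?_ (Def.and ?_ (Def.and ?_ ?_))
  · exact hM.def_eq_pair DefFun.id.fst.fst.fst.fst.fst.fst DefFun.id.fst.fst.fst.snd
      DefFun.id.fst.fst.snd
  · exact Def.isValSubset hM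
      (E := fun a : (((((M × M) × M) × M) × M) × B.Elem) × B.Elem =>
        pairRel a.1.1.1.1.1.2)
      (def_pairRel hM DefFun.id.fst.fst.fst.fst.fst.fst.fst.fst.snd DefFun.id.fst.fst.snd
        DefFun.id.fst.snd DefFun.id.snd)
      DefFun.id.fst.fst.fst.snd DefFun.id.fst.fst.snd DefFun.id.fst.snd
  · exact Def.isValSubset hM
      (E := fun a : (((((M × M) × M) × M) × M) × B.Elem) × B.Elem =>
        pairRel a.1.1.1.1.1.2)
      (def_pairRel hM DefFun.id.fst.fst.fst.fst.fst.fst.fst.fst.snd DefFun.id.fst.fst.snd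
        DefFun.id.fst.snd DefFun.id.snd)
      DefFun.id.fst.fst.snd DefFun.id.fst.fst.fst.snd DefFun.id.snd
  · exact Def.eq DefFun.id.fst.fst.fst.fst.snd (DefFun.id.fst.snd.inf DefFun.id.snd).toModel

/-- The pair of two names. -/
def namePair (hM : IsTransitiveModel M) (p : names M B × names M B) : M :=
  ⟨ZFSet.pair p.1.1 p.2.1, hM.pair_mem (mem_of_mem_names p.1.2) (mem_of_mem_names p.2.2)⟩

omit hB in
theorem namePair_injective (hM : IsTransitiveModel M) :
    Function.Injective (namePair hM : names M B × names M B → M) := fun p q h => by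
  have := ZFSet.pair_inj.1 (Subtype.ext_iff.1 h)
  exact Prod.ext (Subtype.ext this.1) (Subtype.ext this.2)

/-- The rank of a Kuratowski pair depends only on the maximum of the two ranks. It is therefore
insensitive to order, and it drops when both entries do. -/
theorem rank_lt_of_pairPred {z p : M} (h : PairPred z p) : z.1.rank < p.1.rank := by
  obtain ⟨x, y, t, s, a, b, hp, ht, hs, h⟩ := h
  have h1 := rank_lt_of_mem_dom (mem_dom_of_mem ht)
  have h2 := rank_lt_of_mem_dom (mem_dom_of_mem hs)
  have h3 := max_lt_max h1 h2
  rcases h with h | h <;> rw [h, hp, kpair_rank, kpair_rank] <;>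
    simpa [max_comm s.1.rank] using h3

/-- Substituting the definition of `‖t ∈ y‖` leaves a recursion for equality alone: `‖x = y‖`
depends on `‖t = s‖` and `‖s = t‖` for `t ∈ dom x` and `s ∈ dom y`, which is why `PairPred` admits
both orders. The value `⊥` off the pairs of names is a dummy outside the domain of the recursion. -/
theorem isRecursion_valEq (hM : IsTransitiveModel M) :
    IsRecursion PairPred (ValEqStep B) (Set.range (namePair (B := B) hM))
      (Function.extend (namePair (B := B) hM)
        (fun p => toModel M (valEq p.1.1 p.2.1 : B.Elem)) fun _ => toModel M (⊥ : B.Elem)) where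
  wf := Subrelation.wf (fun h => rank_lt_of_pairPred h)
    (InvImage.wf (fun x : M => x.1.rank) wellFounded_lt)
  def_pred := def_pairPred hM
  def_step := def_valEqStep hM
  mem_of_pred := by
    rintro _ ⟨p, rfl⟩ z ⟨x, y, t, s, a, b, hp, ht, hs, h⟩
    obtain ⟨hx, hy⟩ := ZFSet.pair_inj.1 hp
    rw [← hx] at ht
    rw [← hy] at hs
    have ht' := mem_names_of_mem_dom hM p.1.2 ⟨_, ht⟩
    have hs' := mem_names_of_mem_dom hM p.2.2 ⟨_, hs⟩
    rcases h with h | h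
    · exact ⟨(⟨_, ht'⟩, ⟨_, hs'⟩), Subtype.ext h.symm⟩
    · exact ⟨(⟨_, hs'⟩, ⟨_, ht'⟩), Subtype.ext h.symm⟩
  bound := by
    rintro _ ⟨p, rfl⟩
    have h1 := hM.sUnion_mem (hM.sUnion_mem (mem_of_mem_names p.1.2))
    have h2 := hM.sUnion_mem (hM.sUnion_mem (mem_of_mem_names p.2.2))
    -- The square of one set containing both domains bounds the predecessor pairs in either order.
    obtain ⟨a, ha⟩ := hM.exists_prod ⟨_, hM.union_mem h1 h2⟩
    refine ⟨a, ?_⟩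
    rintro z ⟨x, y, t, s, c, d, hp, ht, hs, h⟩
    obtain ⟨hx, hy⟩ := ZFSet.pair_inj.1 hp
    rw [← hx] at ht
    rw [← hy] at hs
    have ht' : t.1 ∈ ZFSet.sUnion (ZFSet.sUnion p.1.1) ∪ ZFSet.sUnion (ZFSet.sUnion p.2.1) :=
      ZFSet.mem_union.2 (.inl (left_mem_sUnion_sUnion ht))
    have hs' : s.1 ∈ ZFSet.sUnion (ZFSet.sUnion p.1.1) ∪ ZFSet.sUnion (ZFSet.sUnion p.2.1) :=
      ZFSet.mem_union.2 (.inr (left_mem_sUnion_sUnion hs))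
    rcases h with h | h <;> rw [h]
    · exact ha _ ht' _ hs'
    · exact ha _ hs' _ ht'
  step := by
    rintro _ ⟨⟨x, y⟩, rfl⟩ g hg v
    have hval (t s : names M B) := (namePair_injective hM).extend_apply
      (fun p => toModel M (valEq p.1.1 p.2.1 : B.Elem)) (fun _ => toModel M (⊥ : B.Elem)) (t, s)
    have hrel (t s : M) (ht : t.1 ∈ names M B) (hs : s.1 ∈ names M B)
        (h : PairPred (namePair hM (⟨_, ht⟩, ⟨_, hs⟩)) (namePair hM (x, y))) (e : B.Elem) :
        pairRel g t s e ↔ e = valEq t.1 s.1 := by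
      have := hg _ h (toModel M e)
      rw [hval, toModel_injective.eq_iff] at this
      rw [← this]
      exact ⟨fun ⟨q, hq, he⟩ => by rwa [hq] at he, fun h => ⟨_, rfl, h⟩⟩
    have hx := x.2
    have hy := y.2
    let x' : M := ⟨x.1, mem_of_mem_names hx⟩
    let y' : M := ⟨y.1, mem_of_mem_names hy⟩
    have hpred (t s : M) (ht : t.1 ∈ dom x.1) (hs : s.1 ∈ dom y.1) (z : M)
        (hz : z.1 = ZFSet.pair t.1 s.1 ∨ z.1 = ZFSet.pair s.1 t.1) :
        PairPred z (namePair hM (x, y)) := by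
      obtain ⟨a, ha⟩ := ht
      obtain ⟨b, hb⟩ := hs
      exact ⟨x', y', t, s, ⟨a, hM.right_mem (hM.mem_of_mem x'.2 ha)⟩,
        ⟨b, hM.right_mem (hM.mem_of_mem y'.2 hb)⟩, rfl, ha, hb, hz⟩
    have hdef : Def M fun p : (M × M) × B.Elem => pairRel g p.1.1 p.1.2 p.2 :=
      def_pairRel hM (.const g) DefFun.id.fst.fst DefFun.id.fst.snd DefFun.id.snd
    have h1 := isValSubset_iff hM hdef (x := x') (y := y') hx hy fun t s ht hs =>
      hrel t s (mem_names_of_mem_dom hM hx ht) (mem_names_of_mem_dom hM hy hs)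
        (hpred t s ht hs _ (.inl rfl))
    -- For the second product the roles are exchanged, so the recorded values at the reversed pairs
    -- are used.
    have h2 := isValSubset_iff hM hdef (x := y') (y := x') hy hx fun t s ht hs =>
      hrel t s (mem_names_of_mem_dom hM hy ht) (mem_names_of_mem_dom hM hx hs)
        (hpred s t hs ht _ (.inr rfl))
    rw [hval, valEq_eq]
    constructor
    · rintro ⟨x₁, y₁, c, c', hp, hc, hc', rfl⟩
      obtain ⟨e1, e2⟩ := ZFSet.pair_inj.1 hp
      obtain rfl : x' = x₁ := Subtype.ext e1
      obtain rfl : y' = y₁ := Subtype.ext e2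
      rw [(h1 c).1 hc, (h2 c').1 hc']
    · rintro rfl
      exact ⟨x', y', _, _, rfl, (h1 _).2 rfl, (h2 _).2 rfl, rfl⟩

/-- `‖x = y‖` is definable over `M`. -/
theorem exists_def_valEq (hM : IsTransitiveModel M) :
    ∃ E : M → M → B.Elem → Prop, (Def M fun p : (M × M) × B.Elem => E p.1.1 p.1.2 p.2) ∧
      ∀ x y : M, x.1 ∈ names M B → y.1 ∈ names M B → ∀ e, E x y e ↔ e = valEq x.1 y.1 := by
  obtain ⟨A, hA, h⟩ := (isRecursion_valEq (B := B) hM).exists_def hM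
  refine ⟨fun x y e => ∃ p : M, p.1 = ZFSet.pair x.1 y.1 ∧ A p (toModel M e),
    Def.ex (Def.and ?_ ?_), fun x y hx hy e => ?_⟩
  · exact hM.def_eq_pair DefFun.id.snd DefFun.id.fst.fst.fst DefFun.id.fst.fst.snd
  · exact hA.comp (DefFun.id.snd.prodMk DefFun.id.fst.snd.toModel)
  have := h (namePair hM (⟨x.1, hx⟩, ⟨y.1, hy⟩)) ⟨_, rfl⟩ (toModel M e)
  rw [(namePair_injective hM).extend_apply, toModel_injective.eq_iff] at this
  rw [← this]
  constructor
  · rintro ⟨p, hp, he⟩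
    exact (Subtype.ext hp : p = namePair hM (⟨x.1, hx⟩, ⟨y.1, hy⟩)) ▸ he
  · intro he
    exact ⟨_, rfl, he⟩

end StarForcing

end

noncomputable section

namespace StarForcing

open FirstOrder DefinableType

/-! ### Quantifier-free sentences -/

theorem tag_injective : Function.Injective tag.{u} := by
  intro m
  induction m with
  | zero =>
    rintro (_ | n) h
    · rfl
    · exact absurd (h ▸ ZFSet.mem_singleton.2 rfl : tag n ∈ tag 0) (ZFSet.notMem_empty _)
  | succ m ih =>
    rintro (_ | n) h
    · exact absurd (h ▸ ZFSet.mem_singleton.2 rfl : tag m ∈ tag 0) (ZFSet.notMem_empty _)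
    · exact congrArg _ (ih (ZFSet.singleton_injective h))

theorem tag_inj {m n : ℕ} : tag.{u} m = tag n ↔ m = n := tag_injective.eq_iff

theorem pair_mem_range_iff {I : ZFSet.{u}} {k : {i // i ∈ I} → ZFSet.{u}} {i q : ZFSet.{u}} :
    ZFSet.pair i q ∈ ZFSet.range (fun i : {i // i ∈ I} => ZFSet.pair i.1 (k i)) ↔
      ∃ j, j.1 = i ∧ k j = q := by
  simp [ZFSet.pair_inj]

theorem range_pair_injective {I J : ZFSet.{u}} {k : {i // i ∈ I} → ZFSet.{u}}
    {l : {i // i ∈ J} → ZFSet.{u}}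
    (h : ZFSet.range (fun i : {i // i ∈ I} => ZFSet.pair i.1 (k i)) =
      ZFSet.range fun i : {i // i ∈ J} => ZFSet.pair i.1 (l i)) :
    I = J ∧ ∀ i hi hi', k ⟨i, hi⟩ = l ⟨i, hi'⟩ := by
  have hmem (i q : ZFSet.{u}) : (∃ j, j.1 = i ∧ k j = q) ↔ ∃ j, j.1 = i ∧ l j = q := by
    rw [← pair_mem_range_iff, h, pair_mem_range_iff]
  refine ⟨?_, fun i hi hi' => ?_⟩
  · ext i
    constructor
    · intro hi
      obtain ⟨j, rfl, -⟩ := (hmem i _).1 ⟨⟨i, hi⟩, rfl, rfl⟩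
      exact j.2
    · intro hi
      obtain ⟨j, rfl, -⟩ := (hmem i _).2 ⟨⟨i, hi⟩, rfl, rfl⟩
      exact j.2
  · obtain ⟨⟨j, hj⟩, rfl, h'⟩ := (hmem i _).1 ⟨⟨i, hi⟩, rfl, rfl⟩
    exact h'.symm

/-- Boolean values are defined on sentences, while `M` sees only codes; injectivity makes the value
a function of the code. -/
theorem QFSent.code_injective {N : Set ZFSet.{u}} :
    Function.Injective (QFSent.code : QFSent N → ZFSet.{u}) := by
  intro φ
  induction φ with
  | eq x y =>
    intro ψ h
    cases ψ <;> simp_all [QFSent.code, ZFSet.pair_inj, tag_inj, Subtype.ext_iff]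
  | mem x y =>
    intro ψ h
    cases ψ <;> simp_all [QFSent.code, ZFSet.pair_inj, tag_inj, Subtype.ext_iff]
  | not φ ih =>
    intro ψ h
    cases ψ <;> simp [QFSent.code, ZFSet.pair_inj, tag_inj] at h
    rw [ih h]
  | iAnd I φ ih =>
    intro ψ h
    cases ψ <;> simp only [QFSent.code, ZFSet.pair_inj, tag_inj, true_and] at h <;> try omega
    obtain ⟨rfl, h⟩ := range_pair_injective h
    exact congrArg _ (funext fun i => ih i (h i.1 i.2 i.2))
  | iOr I φ ih =>
    intro ψ h
    cases ψ <;> simp only [QFSent.code, ZFSet.pair_inj, tag_inj, true_and] at h <;> try omega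
    obtain ⟨rfl, h⟩ := range_pair_injective h
    exact congrArg _ (funext fun i => ih i (h i.1 i.2 i.2))

variable {M : Set ZFSet.{u}} {B : ClassBA.{u}}

theorem code_mem_of_iAnd (hM : IsTransitiveModel M) {I : ZFSet.{u}}
    {φ : {i // i ∈ I} → QFSent (names M B)} (h : QFSent.iAnd I φ ∈ qfSent M B) (j) :
    φ j ∈ qfSent M B :=
  hM.right_mem (hM.mem_of_mem (hM.right_mem h) (pair_mem_range_iff.2 ⟨j, rfl, rfl⟩))

theorem code_mem_of_iOr (hM : IsTransitiveModel M) {I : ZFSet.{u}}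
    {φ : {i // i ∈ I} → QFSent (names M B)} (h : QFSent.iOr I φ ∈ qfSent M B) (j) :
    φ j ∈ qfSent M B :=
  hM.right_mem (hM.mem_of_mem (hM.right_mem h) (pair_mem_range_iff.2 ⟨j, rfl, rfl⟩))

variable [hB : Fact (IsCompleteClassBA M B)]

section

variable (hM : IsTransitiveModel M) {V : M → B.Elem → Prop} {I : ZFSet.{u}}
  {φ : {i // i ∈ I} → QFSent (names M B)} {F : M}

include hM in
omit hB in
theorem setOf_family_eq
    (hF : F.1 = ZFSet.range fun i : {i // i ∈ I} => ZFSet.pair i.1 (φ i).code)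
    (h : ∀ j, ∀ q : M, q.1 = (φ j).code → ∀ d, V q d ↔ d = (φ j).val B) :
    {d | ∃ i q : M, ZFSet.pair i.1 q.1 ∈ F.1 ∧ V q d} = Set.range fun j => (φ j).val B := by
  ext d
  rw [hF]
  constructor
  · rintro ⟨i, q, hq, hd⟩
    obtain ⟨j, -, hj⟩ := pair_mem_range_iff.1 hq
    exact ⟨j, ((h j q hj.symm d).1 hd).symm⟩
  · rintro ⟨j, rfl⟩
    have hj := pair_mem_range_iff (k := fun j => (φ j).code).2 ⟨j, rfl, rfl⟩
    have hj' := hM.mem_of_mem F.2 (hF ▸ hj)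
    exact ⟨⟨_, hM.left_mem hj'⟩, ⟨_, hM.right_mem hj'⟩, hj, (h j _ rfl _).2 rfl⟩

-- Replacement runs over the codes of the members, which lie in `⋃ ⋃ F`, rather than over the
-- indices. This loses nothing, since indices with equal codes contribute equal values.
include hM in
theorem isSetIn_family (hV : Def M fun p : M × B.Elem => V p.1 p.2)
    (hF : F.1 = ZFSet.range fun i : {i // i ∈ I} => ZFSet.pair i.1 (φ i).code)
    (h : ∀ j, ∀ q : M, q.1 = (φ j).code → ∀ d, V q d ↔ d = (φ j).val B) :
    IsSetIn M (Set.range fun j => (φ j).val B) := by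
  rw [← setOf_family_eq hM hF h]
  have hR : Def M fun p : M × B.Elem => (∃ i : M, ZFSet.pair i.1 p.1.1 ∈ F.1) ∧ V p.1 p.2 := by
    refine Def.and (Def.ex ?_) hV
    exact hM.def_pair_mem (.const F) DefFun.id.snd DefFun.id.fst.fst
  convert IsSetIn.of_rel hM (R := fun q d => (∃ i : M, ZFSet.pair i.1 q.1 ∈ F.1) ∧ V q d) hR
    ⟨_, hM.sUnion_mem (hM.sUnion_mem F.2)⟩ ?_ using 1
  · ext d
    constructor
    · rintro ⟨i, q, hq, hd⟩
      exact ⟨q, right_mem_sUnion_sUnion hq, ⟨i, hq⟩, hd⟩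
    · rintro ⟨q, -, ⟨i, hq⟩, hd⟩
      exact ⟨i, q, hq, hd⟩
  · rintro q - d d' ⟨⟨i, hq⟩, hd⟩ ⟨-, hd'⟩
    rw [hF] at hq
    obtain ⟨j, -, hj⟩ := pair_mem_range_iff.1 hq
    rw [(h j q hj.symm d).1 hd, (h j q hj.symm d').1 hd']

end

-- The recursion for sentences

/-- `z` codes an immediate subsentence of the sentence that `c` codes. -/
def SentPred (z c : M) : Prop :=
  c.1 = ZFSet.pair (tag 2) z.1 ∨ ∃ F i : M,
    (c.1 = ZFSet.pair (tag 3) F.1 ∨ c.1 = ZFSet.pair (tag 4) F.1) ∧ ZFSet.pair i.1 z.1 ∈ F.1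

/-- The recursion step for `‖φ‖`, where `E` is the relation `e = ‖x = y‖`. -/
def SentStep (E : M → M → B.Elem → Prop) (c g v : M) : Prop :=
  (∃ (w x y : M) (e : B.Elem), c.1 = ZFSet.pair (tag 0) w.1 ∧ w.1 = ZFSet.pair x.1 y.1 ∧
    E x y e ∧ v = toModel M e) ∨
  (∃ (w x y : M) (e : B.Elem), c.1 = ZFSet.pair (tag 1) w.1 ∧ w.1 = ZFSet.pair x.1 y.1 ∧
    IsValMem E x y e ∧ v = toModel M e) ∨
  (∃ (q : M) (e : B.Elem), c.1 = ZFSet.pair (tag 2) q.1 ∧ ZFSet.pair q.1 e.val ∈ g.1 ∧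
    v = toModel M eᶜ) ∨
  (∃ (F : M) (e : B.Elem), c.1 = ZFSet.pair (tag 3) F.1 ∧
    IsGLB {d : B.Elem | ∃ i q : M, ZFSet.pair i.1 q.1 ∈ F.1 ∧ ZFSet.pair q.1 d.val ∈ g.1} e ∧
    v = toModel M e) ∨
  (∃ (F : M) (e : B.Elem), c.1 = ZFSet.pair (tag 4) F.1 ∧
    IsLUB {d : B.Elem | ∃ i q : M, ZFSet.pair i.1 q.1 ∈ F.1 ∧ ZFSet.pair q.1 d.val ∈ g.1} e ∧
    v = toModel M e)

omit hB in
theorem def_eq_tag_pair (hM : IsTransitiveModel M) {α : Type*} [DefinableType M α] (n : ℕ)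
    {f g : α → M} (hf : DefFun M f) (hg : DefFun M g) :
    Def M fun a => (f a).1 = ZFSet.pair (tag n) (g a).1 :=
  hM.def_eq_pair (g := fun _ => ⟨tag n, hM.tag_mem n⟩) hf (.const _) hg

omit hB in
theorem def_sentPred (hM : IsTransitiveModel M) : Def M fun p : M × M => SentPred p.1 p.2 := by
  refine Def.or (def_eq_tag_pair hM 2 DefFun.id.snd DefFun.id.fst) ?_
  iterate 2 refine Def.ex ?_
  refine Def.and (Def.or ?_ ?_) ?_
  · exact def_eq_tag_pair hM 3 DefFun.id.fst.fst.snd DefFun.id.fst.snd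
  · exact def_eq_tag_pair hM 4 DefFun.id.fst.fst.snd DefFun.id.fst.snd
  · exact hM.def_pair_mem DefFun.id.fst.snd DefFun.id.snd DefFun.id.fst.fst.fst

theorem def_sentStep (hM : IsTransitiveModel M) {E : M → M → B.Elem → Prop}
    (hE : Def M fun p : (M × M) × B.Elem => E p.1.1 p.1.2 p.2) :
    Def M fun p : (M × M) × M => SentStep E p.1.1 p.1.2 p.2 := by
  refine Def.or ?_ (Def.or ?_ (Def.or ?_ (Def.or ?_ ?_)))
  · iterate 4 refine Def.ex ?_
    refine Def.and ?_ (Def.and ?_ (Def.and ?_ ?_))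
    · exact def_eq_tag_pair hM 0 DefFun.id.fst.fst.fst.fst.fst.fst DefFun.id.fst.fst.fst.snd
    · exact hM.def_eq_pair DefFun.id.fst.fst.fst.snd DefFun.id.fst.fst.snd DefFun.id.fst.snd
    · exact hE.comp ((DefFun.id.fst.fst.snd.prodMk DefFun.id.fst.snd).prodMk DefFun.id.snd)
    · exact Def.eq DefFun.id.fst.fst.fst.fst.snd DefFun.id.snd.toModel
  · iterate 4 refine Def.ex ?_
    refine Def.and ?_ (Def.and ?_ (Def.and ?_ ?_))
    · exact def_eq_tag_pair hM 1 DefFun.id.fst.fst.fst.fst.fst.fst DefFun.id.fst.fst.fst.snd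
    · exact hM.def_eq_pair DefFun.id.fst.fst.fst.snd DefFun.id.fst.fst.snd DefFun.id.fst.snd
    · exact Def.isValMem hM (E := fun _ => E)
        (hE.comp ((DefFun.id.fst.fst.snd.prodMk DefFun.id.fst.snd).prodMk DefFun.id.snd))
        DefFun.id.fst.fst.snd DefFun.id.fst.snd DefFun.id.snd
    · exact Def.eq DefFun.id.fst.fst.fst.fst.snd DefFun.id.snd.toModel
  · iterate 2 refine Def.ex ?_
    refine Def.and ?_ (Def.and ?_ ?_)
    · exact def_eq_tag_pair hM 2 DefFun.id.fst.fst.fst.fst DefFun.id.fst.snd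
    · exact Def.pair_val_mem hM DefFun.id.fst.fst.fst.snd DefFun.id.fst.snd DefFun.id.snd
    · exact Def.eq DefFun.id.fst.fst.snd DefFun.id.snd.compl.toModel
  · iterate 2 refine Def.ex ?_
    refine Def.and ?_ (Def.and (Def.isGLB ?_ ?_) ?_)
    · exact def_eq_tag_pair hM 3 DefFun.id.fst.fst.fst.fst DefFun.id.fst.snd
    · iterate 2 refine Def.ex ?_
      refine Def.and ?_ ?_
      · exact hM.def_pair_mem DefFun.id.fst.fst.fst.fst.snd DefFun.id.fst.snd DefFun.id.snd
      · exact Def.pair_val_mem hM DefFun.id.fst.fst.fst.fst.fst.fst.snd DefFun.id.snd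
          DefFun.id.fst.fst.snd
    · exact DefFun.id.snd
    · exact Def.eq DefFun.id.fst.fst.snd DefFun.id.snd.toModel
  · iterate 2 refine Def.ex ?_
    refine Def.and ?_ (Def.and (Def.isLUB ?_ ?_) ?_)
    · exact def_eq_tag_pair hM 4 DefFun.id.fst.fst.fst.fst DefFun.id.fst.snd
    · iterate 2 refine Def.ex ?_
      refine Def.and ?_ ?_
      · exact hM.def_pair_mem DefFun.id.fst.fst.fst.fst.snd DefFun.id.fst.snd DefFun.id.snd
      · exact Def.pair_val_mem hM DefFun.id.fst.fst.fst.fst.fst.fst.snd DefFun.id.snd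
          DefFun.id.fst.fst.snd
    · exact DefFun.id.snd
    · exact Def.eq DefFun.id.fst.fst.snd DefFun.id.snd.toModel

/-- The code of a sentence, as an element of `M`. -/
def sentCode (φ : qfSent M B) : M := ⟨φ.1.code, φ.2⟩

omit hB in
theorem sentCode_injective : Function.Injective (sentCode : qfSent M B → M) := fun _ _ h =>
  Subtype.ext (QFSent.code_injective (Subtype.ext_iff.1 h))

omit hB in
theorem rank_lt_of_sentPred {z c : M} (h : SentPred z c) : z.1.rank < c.1.rank := by
  have key (x y : ZFSet.{u}) : y.rank < (ZFSet.pair x y).rank := by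
    rw [kpair_rank]
    exact (le_max_right _ _).trans_lt ((Order.lt_succ _).trans (Order.lt_succ _))
  rcases h with h | ⟨F, i, h, hz⟩
  · exact h ▸ key _ _
  · refine (key i.1 z.1).trans ((ZFSet.rank_lt_of_mem hz).trans ?_)
    rcases h with h | h <;> exact h ▸ key _ _

/-- The atomic clauses use the definable relation `E` already obtained for equality, and the others
use the recorded values of immediate subsentences. In the infinitary clauses those records place the
family of values in `M`, so the bound required by `SentStep` exists and equals the one chosen by
`bProd` or `bSum`. -/
theorem isRecursion_val (hM : IsTransitiveModel M) {E : M → M → B.Elem → Prop}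
    (hE : Def M fun p : (M × M) × B.Elem => E p.1.1 p.1.2 p.2)
    (hval : ∀ x y : M, x.1 ∈ names M B → y.1 ∈ names M B → ∀ e, E x y e ↔ e = valEq x.1 y.1) :
    IsRecursion SentPred (SentStep E) (Set.range (sentCode (B := B)))
      (Function.extend (sentCode (B := B))
        (fun φ => toModel M (φ.1.val B)) fun _ => toModel M (⊥ : B.Elem)) where
  wf := Subrelation.wf (fun h => rank_lt_of_sentPred h)
    (InvImage.wf (fun x : M => x.1.rank) wellFounded_lt)
  def_pred := def_sentPred hM
  def_step := def_sentStep hM hE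
  mem_of_pred := by
    rintro _ ⟨⟨φ, hφ⟩, rfl⟩ z hz
    suffices h : ∃ ψ : QFSent (names M B), ψ.code = z.1 by
      obtain ⟨ψ, h⟩ := h
      exact ⟨⟨ψ, by rw [qfSent, Set.mem_ofPred_eq, h]; exact z.2⟩, Subtype.ext h⟩
    rcases hz with h | ⟨F, i, h, hz⟩
    · cases φ <;> simp [sentCode, QFSent.code, ZFSet.pair_inj, tag_inj] at h
      exact ⟨_, h⟩
    · cases φ <;> simp only [sentCode, QFSent.code, ZFSet.pair_inj, tag_inj] at h
      all_goals try omega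
      all_goals
        have hF := h.elim And.right And.right
        rw [← hF] at hz
        obtain ⟨j, -, hj⟩ := pair_mem_range_iff.1 hz
        exact ⟨_, hj⟩
  bound := by
    rintro c -
    have h1 := hM.sUnion_mem c.2
    have h2 := hM.sUnion_mem (hM.sUnion_mem (hM.sUnion_mem h1))
    -- A negated sentence appears after one union. A member of a family appears after four: one
    -- reaches the family, one its pairs, and two the entries of a pair.
    refine ⟨⟨_, hM.union_mem h1 h2⟩, fun z hz => ZFSet.mem_union.2 ?_⟩
    have key (x y : ZFSet.{u}) : y ∈ ZFSet.sUnion (ZFSet.pair x y) :=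
      ZFSet.mem_sUnion.2 ⟨{x, y}, by simp [ZFSet.pair], by simp⟩
    rcases hz with h | ⟨F, i, h, hz⟩
    · exact .inl (h ▸ key _ _)
    · have hF : F.1 ∈ ZFSet.sUnion c.1 := by
        rcases h with h | h <;> exact h ▸ key _ _
      exact .inr (right_mem_sUnion_sUnion (ZFSet.mem_sUnion.2 ⟨_, hF, hz⟩))
  step := by
    rintro _ ⟨⟨φ, hφ⟩, rfl⟩ g hg v
    have hext (ψ : qfSent M B) := sentCode_injective.extend_apply
      (fun φ => toModel M (φ.1.val B)) (fun _ => toModel M (⊥ : B.Elem)) ψ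
    have hrel (ψ : QFSent (names M B)) (q : M) (hq : q.1 = ψ.code)
        (h : SentPred q (sentCode ⟨φ, hφ⟩)) (e : B.Elem) :
        ZFSet.pair q.1 e.val ∈ g.1 ↔ e = ψ.val B := by
      have hψ : ψ ∈ qfSent M B := (hq ▸ q.2 : ψ.code ∈ M)
      obtain rfl : q = sentCode ⟨ψ, hψ⟩ := Subtype.ext hq
      have := hg _ h (toModel M e)
      rwa [hext, toModel_injective.eq_iff] at this
    have hdef : Def M fun p : M × B.Elem => ZFSet.pair p.1.1 p.2.val ∈ g.1 :=
      Def.pair_val_mem hM (.const g) DefFun.id.fst DefFun.id.snd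
    rw [hext]
    cases φ with
    | eq x y =>
      let x' : M := ⟨x.1, mem_of_mem_names x.2⟩
      let y' : M := ⟨y.1, mem_of_mem_names y.2⟩
      have h := hval x' y' x.2 y.2
      constructor
      -- The tags are distinct, so only the clause matching the outermost symbol survives; the other
      -- cases below argue in the same way.
      · rintro (⟨w, a, b, e, hc, hw, he, rfl⟩ | ⟨w, a, b, e, hc, -⟩ | ⟨q, e, hc, -⟩ |
          ⟨F, e, hc, -⟩ | ⟨F, e, hc, -⟩) <;>
          simp only [sentCode, QFSent.code, ZFSet.pair_inj, tag_inj] at hc <;> try omega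
        rw [← hc.2, ZFSet.pair_inj] at hw
        obtain rfl : x' = a := Subtype.ext hw.1
        obtain rfl : y' = b := Subtype.ext hw.2
        rw [(h e).1 he]
        rfl
      · rintro rfl
        exact .inl ⟨⟨_, hM.right_mem hφ⟩, x', y', _, rfl, rfl, (h _).2 rfl, rfl⟩
    | mem x y =>
      let x' : M := ⟨x.1, mem_of_mem_names x.2⟩
      let y' : M := ⟨y.1, mem_of_mem_names y.2⟩
      have h := isValMem_iff hM hE (t := x') (y := y') y.2 fun s hs =>
        hval x' s x.2 (mem_names_of_mem_dom hM y.2 hs)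
      constructor
      · rintro (⟨w, a, b, e, hc, -⟩ | ⟨w, a, b, e, hc, hw, he, rfl⟩ | ⟨q, e, hc, -⟩ |
          ⟨F, e, hc, -⟩ | ⟨F, e, hc, -⟩) <;>
          simp only [sentCode, QFSent.code, ZFSet.pair_inj, tag_inj] at hc <;> try omega
        rw [← hc.2, ZFSet.pair_inj] at hw
        obtain rfl : x' = a := Subtype.ext hw.1
        obtain rfl : y' = b := Subtype.ext hw.2
        rw [(h e).1 he]
        rfl
      · rintro rfl
        exact .inr (.inl ⟨⟨_, hM.right_mem hφ⟩, x', y', _, rfl, rfl, (h _).2 rfl, rfl⟩)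
    | not ψ =>
      constructor
      · rintro (⟨w, a, b, e, hc, -⟩ | ⟨w, a, b, e, hc, -⟩ | ⟨q, e, hc, he, rfl⟩ |
          ⟨F, e, hc, -⟩ | ⟨F, e, hc, -⟩) <;>
          simp only [sentCode, QFSent.code, ZFSet.pair_inj, tag_inj] at hc <;> try omega
        rw [(hrel ψ q hc.2.symm (.inl (by rw [← hc.2]; rfl)) e).1 he]
        rfl
      · rintro rfl
        exact .inr (.inr (.inl ⟨⟨_, hM.right_mem hφ⟩, ψ.val B, rfl,
          (hrel ψ ⟨_, hM.right_mem hφ⟩ rfl (.inl rfl) _).2 rfl, rfl⟩))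
    | iAnd I ψ =>
      let F : M := ⟨_, hM.right_mem hφ⟩
      have hV (j) (q : M) (hq : q.1 = (ψ j).code) (d : B.Elem) :
          ZFSet.pair q.1 d.val ∈ g.1 ↔ d = (ψ j).val B := by
        have hj : ZFSet.pair j.1 q.1 ∈ F.1 := pair_mem_range_iff.2 ⟨j, rfl, hq.symm⟩
        exact hrel _ q hq (.inr ⟨F, ⟨_, hM.left_mem (hM.mem_of_mem F.2 hj)⟩, .inl rfl, hj⟩) d
      have hs := isGLB_bProd ((isSetIn_family hM hdef (F := F) rfl hV).exists_isGLB hM)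
      have he := setOf_family_eq hM (F := F) rfl hV
      constructor
      · rintro (⟨w, a, b, e, hc, -⟩ | ⟨w, a, b, e, hc, -⟩ | ⟨q, e, hc, -⟩ |
          ⟨F', e, hc, h, rfl⟩ | ⟨F', e, hc, -⟩) <;>
          simp only [sentCode, QFSent.code, ZFSet.pair_inj, tag_inj] at hc <;> try omega
        obtain rfl : F = F' := Subtype.ext hc.2
        rw [he] at h
        rw [h.unique hs]
        rfl
      · rintro rfl
        exact .inr (.inr (.inr (.inl ⟨F, _, rfl, by rw [he]; exact hs, rfl⟩)))
    | iOr I ψ =>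
      let F : M := ⟨_, hM.right_mem hφ⟩
      have hV (j) (q : M) (hq : q.1 = (ψ j).code) (d : B.Elem) :
          ZFSet.pair q.1 d.val ∈ g.1 ↔ d = (ψ j).val B := by
        have hj : ZFSet.pair j.1 q.1 ∈ F.1 := pair_mem_range_iff.2 ⟨j, rfl, hq.symm⟩
        exact hrel _ q hq (.inr ⟨F, ⟨_, hM.left_mem (hM.mem_of_mem F.2 hj)⟩, .inr rfl, hj⟩) d
      have hs := isLUB_bSum (isSetIn_family hM hdef (F := F) rfl hV).exists_isLUB
      have he := setOf_family_eq hM (F := F) rfl hV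
      constructor
      · rintro (⟨w, a, b, e, hc, -⟩ | ⟨w, a, b, e, hc, -⟩ | ⟨q, e, hc, -⟩ |
          ⟨F', e, hc, -⟩ | ⟨F', e, hc, h, rfl⟩) <;>
          simp only [sentCode, QFSent.code, ZFSet.pair_inj, tag_inj] at hc <;> try omega
        obtain rfl : F = F' := Subtype.ext hc.2
        rw [he] at h
        rw [h.unique hs]
        rfl
      · rintro rfl
        exact .inr (.inr (.inr (.inr ⟨F, _, rfl, by rw [he]; exact hs, rfl⟩)))

/-- `‖φ‖` is definable over `M`. -/
theorem exists_def_val (hM : IsTransitiveModel M) :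
    ∃ V : M → B.Elem → Prop, (Def M fun p : M × B.Elem => V p.1 p.2) ∧
      ∀ φ ∈ qfSent M B, ∀ q : M, q.1 = φ.code → ∀ d, V q d ↔ d = φ.val B := by
  obtain ⟨E, hE, hval⟩ := exists_def_valEq (B := B) hM
  obtain ⟨A, hA, h⟩ := (isRecursion_val hM hE hval).exists_def hM
  refine ⟨fun q d => A q (toModel M d),
    hA.comp (DefFun.id.fst.prodMk DefFun.id.snd.toModel), fun φ hφ q hq d => ?_⟩
  obtain rfl : q = sentCode ⟨φ, hφ⟩ := Subtype.ext hq
  beta_reduce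
  rw [h _ ⟨_, rfl⟩, sentCode_injective.extend_apply, toModel_injective.eq_iff]

theorem isSetIn_of_iAnd (hM : IsTransitiveModel M) {I : ZFSet.{u}}
    {φ : {i // i ∈ I} → QFSent (names M B)} (h : QFSent.iAnd I φ ∈ qfSent M B) :
    IsSetIn M (Set.range fun j => (φ j).val B) := by
  obtain ⟨V, hV, hval⟩ := exists_def_val (B := B) hM
  exact isSetIn_family hM hV (F := ⟨_, hM.right_mem h⟩) rfl fun j =>
    hval _ (code_mem_of_iAnd hM h j)

theorem isSetIn_of_iOr (hM : IsTransitiveModel M) {I : ZFSet.{u}}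
    {φ : {i // i ∈ I} → QFSent (names M B)} (h : QFSent.iOr I φ ∈ qfSent M B) :
    IsSetIn M (Set.range fun j => (φ j).val B) := by
  obtain ⟨V, hV, hval⟩ := exists_def_val (B := B) hM
  exact isSetIn_family hM hV (F := ⟨_, hM.right_mem h⟩) rfl fun j =>
    hval _ (code_mem_of_iOr hM h j)

/-! ### The forcing theorem -/

theorem isSetIn_valMem_of_names (hM : IsTransitiveModel M) {t y : ZFSet.{u}}
    (ht : t ∈ names M B) (hy : y ∈ names M B) :
    IsSetIn M {c : B.Elem | ∃ s ∈ dom y, c = valEq t s ⊓ starMem s y} := by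
  obtain ⟨E, hE, hval⟩ := exists_def_valEq (B := B) hM
  exact isSetIn_valMem hM hE (t := ⟨t, mem_of_mem_names ht⟩) (y := ⟨y, mem_of_mem_names hy⟩) hy
    fun s hs => hval _ s ht (mem_names_of_mem_dom hM hy hs)

theorem isSetIn_valSubset_of_names (hM : IsTransitiveModel M) {x y : ZFSet.{u}}
    (hx : x ∈ names M B) (hy : y ∈ names M B) :
    IsSetIn M {c : B.Elem | ∃ t ∈ dom x, c = (starMem t x)ᶜ ⊔ valMem t y} := by
  obtain ⟨E, hE, hval⟩ := exists_def_valEq (B := B) hM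
  exact isSetIn_valSubset hM hE (x := ⟨x, mem_of_mem_names hx⟩) (y := ⟨y, mem_of_mem_names hy⟩)
    hx hy fun t s ht hs => hval t s (mem_names_of_mem_dom hM hx ht) (mem_names_of_mem_dom hM hy hs)

omit hB in
theorem mem_interp {G : Set B.Elem} {x z : ZFSet.{u}} :
    z ∈ interp G x ↔ ∃ t, ∃ b ∈ G, ZFSet.pair t b.val ∈ x ∧ interp G t = z := by
  rw [interp, ZFSet.mem_range]
  constructor
  · rintro ⟨⟨⟨t, -⟩, b, hb, h⟩, rfl⟩
    exact ⟨t, b, hb, h, rfl⟩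
  · rintro ⟨t, b, hb, h, rfl⟩
    exact ⟨⟨⟨t, left_mem_sUnion_sUnion h⟩, b, hb, h⟩, rfl⟩

omit hB in
theorem mem_interp_iff {G : Set B.Elem} {x z : ZFSet.{u}} (hx : x ∈ names M B) :
    z ∈ interp G x ↔ ∃ t ∈ dom x, starMem t x ∈ G ∧ interp G t = z := by
  rw [mem_interp]
  constructor
  · rintro ⟨t, b, hb, h, rfl⟩
    exact ⟨t, ⟨_, h⟩, by rwa [starMem_eq hx h], rfl⟩
  · rintro ⟨t, ht, hb, rfl⟩
    exact ⟨t, _, hb, pair_starMem_mem hx ht, rfl⟩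

section

variable {G : Set B.Elem} (hM : IsTransitiveModel M) (hG : IsCompleteUltrafilter M B G)
include hM hG

/-- Completeness of `G` turns the sum into a single `s ∈ dom y` with `‖t = s‖` and `y(s)` both in
`G`, that is, an element of `i_G(y)` equal to `i_G(t)`. -/
theorem valMem_mem_iff_of_valEq {t y : ZFSet.{u}} (ht : t ∈ names M B) (hy : y ∈ names M B)
    (h : ∀ s ∈ dom y, (valEq t s ∈ G ↔ interp G t = interp G s)) :
    valMem t y ∈ G ↔ interp G t ∈ interp G y := by
  rw [valMem_eq, hG.bSum_mem_iff (isSetIn_valMem_of_names hM ht hy), mem_interp_iff hy]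
  constructor
  · rintro ⟨_, ⟨s, hs, rfl⟩, hd⟩
    obtain ⟨h1, h2⟩ := hG.inf_mem_iff.1 hd
    exact ⟨s, hs, h2, ((h s hs).1 h1).symm⟩
  · rintro ⟨s, hs, h1, h2⟩
    exact ⟨_, ⟨s, hs, rfl⟩, hG.inf_mem_iff.2 ⟨(h s hs).2 h2.symm, h1⟩⟩

theorem valSubset_mem_iff_of_valMem {x y : ZFSet.{u}} (hx : x ∈ names M B) (hy : y ∈ names M B)
    (h : ∀ t ∈ dom x, (valMem t y ∈ G ↔ interp G t ∈ interp G y)) :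
    bProd {c : B.Elem | ∃ t ∈ dom x, c = (starMem t x)ᶜ ⊔ valMem t y} ∈ G ↔
      interp G x ⊆ interp G y := by
  rw [hG.bProd_mem_iff hM (isSetIn_valSubset_of_names hM hx hy)]
  constructor
  · intro h' z hz
    obtain ⟨t, ht, hb, rfl⟩ := (mem_interp_iff hx).1 hz
    exact (h t ht).1 (hG.compl_sup_mem_iff.1 (h' _ ⟨t, ht, rfl⟩) hb)
  · rintro h' _ ⟨t, ht, rfl⟩
    exact hG.compl_sup_mem_iff.2 fun hb =>
      (h t ht).2 (h' ((mem_interp_iff hx).2 ⟨t, ht, hb, rfl⟩))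

/-- The induction is on the rank of `x` alone, with `y` arbitrary. The second product involves `‖s =
t‖` with the lower-rank `t ∈ dom x` on the right, so both orders are carried along and symmetry of
`valEq` is not needed. -/
theorem valEq_mem_iff_and {x : ZFSet.{u}} : x ∈ names M B → ∀ y ∈ names M B,
    (valEq x y ∈ G ↔ interp G x = interp G y) ∧ (valEq y x ∈ G ↔ interp G y = interp G x) := by
  induction x using (InvImage.wf ZFSet.rank.{u} wellFounded_lt).induction with
  | _ x ih =>
    intro hx y hy
    have ih' (t : ZFSet.{u}) (ht : t ∈ dom x) :=
      ih t (rank_lt_of_mem_dom ht) (mem_names_of_mem_dom hM hx ht)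
    have h1 := valSubset_mem_iff_of_valMem hM hG hx hy fun t ht =>
      valMem_mem_iff_of_valEq hM hG (mem_names_of_mem_dom hM hx ht) hy fun s hs =>
        (ih' t ht s (mem_names_of_mem_dom hM hy hs)).1
    have h2 := valSubset_mem_iff_of_valMem hM hG hy hx fun s hs =>
      valMem_mem_iff_of_valEq hM hG (mem_names_of_mem_dom hM hy hs) hx fun t ht =>
        (ih' t ht s (mem_names_of_mem_dom hM hy hs)).2
    rw [valEq_eq, valEq_eq, hG.inf_mem_iff, hG.inf_mem_iff, h1, h2]
    exact ⟨⟨fun h => h.1.antisymm h.2, fun h => h ▸ ⟨subset_rfl, subset_rfl⟩⟩,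
      ⟨fun h => h.1.antisymm h.2, fun h => h ▸ ⟨subset_rfl, subset_rfl⟩⟩⟩

theorem valEq_mem_iff {x y : ZFSet.{u}} (hx : x ∈ names M B) (hy : y ∈ names M B) :
    valEq x y ∈ G ↔ interp G x = interp G y :=
  (valEq_mem_iff_and hM hG hx y hy).1

theorem valMem_mem_iff {x y : ZFSet.{u}} (hx : x ∈ names M B) (hy : y ∈ names M B) :
    valMem x y ∈ G ↔ interp G x ∈ interp G y :=
  valMem_mem_iff_of_valEq hM hG hx hy fun _ hs =>
    valEq_mem_iff hM hG hx (mem_names_of_mem_dom hM hy hs)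

/-- Subsentences of a sentence in `M` are again in `M` by transitivity. At an infinitary connective
the set of values is in `M`, so completeness of `G` commutes with the connective. -/
theorem holds_iff_val_mem {φ : QFSent (names M B)} :
    φ ∈ qfSent M B → (φ.Holds (interpName M B G) ↔ φ.val B ∈ G) := by
  induction φ with
  | eq x y =>
    intro _
    exact Subtype.ext_iff.trans (valEq_mem_iff hM hG x.2 y.2).symm
  | mem x y =>
    intro _
    exact (valMem_mem_iff hM hG x.2 y.2).symm
  | not φ ih =>
    intro h
    exact (not_congr (ih (hM.right_mem h))).trans hG.compl_mem_iff.symm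
  | iAnd I φ ih =>
    intro h
    rw [QFSent.val, hG.bProd_mem_iff hM (isSetIn_of_iAnd hM h), Set.forall_mem_range]
    exact forall_congr' fun j => ih j (code_mem_of_iAnd hM h j)
  | iOr I φ ih =>
    intro h
    rw [QFSent.val, hG.bSum_mem_iff (isSetIn_of_iOr hM h), Set.exists_range_iff]
    exact exists_congr fun j => ih j (code_mem_of_iOr hM h j)

end

theorem valuesDefined (hM : IsTransitiveModel M) : ValuesDefined M B where
  eq _ hx _ hy := (isSetIn_valSubset_of_names hM hx hy).exists_isGLB hM
  mem _ hx _ hy := (isSetIn_valMem_of_names hM hx hy).exists_isLUB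
  iAnd _ _ h := (isSetIn_of_iAnd hM h).exists_isGLB hM
  iOr _ _ h := (isSetIn_of_iOr hM h).exists_isLUB

end StarForcing

end

theorem mainTheorem6 (M : Set ZFSet.{u}) (B : StarForcing.ClassBA.{u}) (G : Set B.Elem)
    (h : StarForcing.IsStarForcingNotion M B G) :
    StarForcing.ValuesDefined M B ∧
      ∀ φ ∈ StarForcing.qfSent M B,
        φ.Holds (StarForcing.interpName M B G) ↔ φ.val B ∈ G := by
  have : Fact (StarForcing.IsCompleteClassBA M B) := ⟨h.algebra⟩
  exact ⟨StarForcing.valuesDefined h.model, fun _ hφ =>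
    StarForcing.holds_iff_val_mem h.model h.ultrafilter hφ⟩
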